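/- **Definitions.** Let $D$ be an $n\times n$ matrix with non-negative integer entries. A *graph realisation* of $D$ is a pair $(G,\Phi)$ of a simple undirected graph $G=(V,E)$ and an injective map $\Phi:[n]\to V$ such that the shortest-path distance $d_G$ satisfies $d_G(\Phi(i),\Phi(j))=D_{ij}$ for all $i,j\in[n]$. The problem 2-CombDMR asks, given $D$, whether $D$ has a graph realisation with $|V|\le n+2$. $D$ is a *distance matrix* if its diagonal entries are $0$, its off-diagonal entries are positive, it is symmetric, and $D_{ij}\le D_{iw}+D_{wj}$ for all $i,j,w$. For $q\in\mathbb N$ the *$q$-skeleton* of a distance matrix $D$ is the weighted graph on $[n]$ in which distinct $i,j$ are joined, by an edge of length $D_{ij}$, if and only if $D_{ij}\le q$; $D^{(q)}_{ij}\in\mathbb N_0\cup\{\infty\}$ is the length of a shortest path from $i$ to $j$ in it. $G_D$ is the unweighted 1-skeleton, with vertices $v_1,\dots,v_n$. With Boolean variables $x_{i,e}$ ($i\in[n]$, $e\in\{n+1,n+2\}$; "$v_i$ is adjacent to $v_e$"), let $\phi_2$ be the 2-CNF formula with the following clauses, for all $i,j\in[n]$: if $D_{ij}>2$, the clauses $\bar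 x_{i,n+1}\vee\bar x_{j,n+1}$ and $\bar x_{i,n+2}\vee\bar x_{j,n+2}$; if $D_{ij}=2$ and $d_{G_D}(v_i,v_j)>2$, the clauses $x_{i,n+1}\vee x_{i,n+2}$, $x_{j,n+1}\vee x_{j,n+2}$, $x_{i,n+1}\vee x_{j,n+2}$, $x_{i,n+2}\vee x_{j,n+1}$. Let $\phi_2'$ consist of the clauses of $\phi_2$ together with, for all $i,j\in[n]$: if $D_{ij}>3$, the clauses $\bar x_{i,n+1}\vee\bar x_{j,n+2}$ and $\bar x_{i,n+2}\vee\bar x_{j,n+1}$; if $D_{ij}=3$ and $D^{(2)}_{ij}>3$, the clauses $x_{i,n+1}\vee x_{i,n+2}$, $x_{j,n+1}\vee x_{j,n+2}$, $x_{i,n+1}\vee x_{j,n+1}$, $x_{i,n+2}\vee x_{j,n+2}$. For an assignment $X$, let $G_X$ be the graph on $v_1,\dots,v_{n+2}$ whose induced subgraph on $v_1,\dots,v_n$ is $G_D$, in which $v_i$ ($i\le n$) is adjacent to $v_e$ if and only if $x_{i,e}$ is true, and in which $v_{n+1},v_{n+2}$ are not adjacent; let $G'_X$ be $G_X$ with the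 additional edge $\{v_{n+1},v_{n+2}\}$. **Theorem.** 1. 2-CombDMR is solvable in polynomial time: there is a (multi-stack) Turing machine that, given $D$ (a matrix of non-negative integers written in binary, row by row), decides in time polynomial in the length of the input whether $D$ is a YES-instance. Moreover, there is such a machine, with the same polynomial time bound, that for every YES-instance $D$ outputs a graph $G$ with exactly $n+2$ vertices $v_1,\dots,v_{n+2}$ such that $(G,\Phi)$, where $\Phi(i)=v_i$, is a graph realisation of $D$, and for every other $D$ outputs that there is none. The graph it outputs is $G_X$ for a satisfying assignment $X$ of $\phi_2$ or $G'_X$ for a satisfying assignment $X$ of $\phi_2'$. 2. Let $D$ be a distance matrix. For every satisfying assignment $X$ of $\phi_2$, the distance matrix of $G_X$ on $v_1,\dots,v_n$ equals $D^{(2)}$; for every satisfying assignment $X$ of $\phi_2'$, the distance matrix of $G'_X$ on $v_1,\dots,v_n$ equals $D^{(3)}$. Furthermore, $D$ has a graph realisation $(G,\Phi)$ with $|V|=n+2$ in which the two vertices outside $\Phi([n])$ are non-adjacent if and only if $\phi_2$ is satisfiable and $D^{(2)}=D$, and one in which they are adjacent if and only if $\phi_2'$ is satisfiable and $D^{(3)}=D$.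 -/

import Mathlib

namespace CombDMR

open Computability

/-! ### Graph realisations of a matrix -/

/-- `(G, Φ)` is a graph realisation of `D`: `Φ` is injective and the shortest-path distance of `G`
(with value `∞` between different components) restricts to `D` along `Φ`. -/
def IsRealisation {n : ℕ} {V : Type} (D : Matrix (Fin n) (Fin n) ℕ) (G : SimpleGraph V)
    (Φ : Fin n → V) : Prop :=
  Function.Injective Φ ∧ ∀ i j, G.edist (Φ i) (Φ j) = (D i j : ℕ∞)

/-- `D` is a YES-instance of the `k`-combinatorial distance matrix realisation problem: it has a
graph realisation with at most `n + k` vertices. -/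
def IsYesInstance (k : ℕ) {n : ℕ} (D : Matrix (Fin n) (Fin n) ℕ) : Prop :=
  ∃ (V : Type) (_ : Fintype V) (G : SimpleGraph V) (Φ : Fin n → V),
    Fintype.card V ≤ n + k ∧ IsRealisation D G Φ

/-- Distance matrices: zero diagonal, positive off the diagonal, symmetric, triangle inequality. -/
structure IsDistanceMatrix {n : ℕ} (D : Matrix (Fin n) (Fin n) ℕ) : Prop where
  diag : ∀ i, D i i = 0
  pos : ∀ i j, i ≠ j → 0 < D i j
  symm : ∀ i j, D i j = D j i
  triangle : ∀ i j w, D i j ≤ D i w + D w j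

/-- The edges of the `q`-skeleton of a (symmetric) matrix `D`: pairs of different indices at
`D`-distance at most `q`. -/
def skeleton {n : ℕ} (D : Matrix (Fin n) (Fin n) ℕ) (q : ℕ) : SimpleGraph (Fin n) :=
  SimpleGraph.fromRel fun i j => D i j ≤ q

/-- The matrix `D^(q)`: shortest-path distances in the `q`-skeleton of `D`, where the edge `{i, j}`
has length `D i j`; the value is `∞` if there is no path. -/
noncomputable def skeletonDist {n : ℕ} (D : Matrix (Fin n) (Fin n) ℕ) (q : ℕ) (i j : Fin n) : ℕ∞ :=
  ⨅ p : (skeleton D q).Walk i j, (p.darts.map fun d => (D d.fst d.snd : ℕ∞)).sum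

/-! ### 2-CNF formulas -/

/-- A literal: the variable `var`, negated if `sign` is `false`. -/
structure Literal (α : Type) where
  var : α
  sign : Bool

/-- A 2-CNF formula, as its set of clauses; each clause is a disjunction of two literals. -/
abbrev TwoCNF (α : Type) := Set (Literal α × Literal α)

def Satisfies {α : Type} (X : α → Bool) (φ : TwoCNF α) : Prop :=
  ∀ c ∈ φ, X c.1.var = c.1.sign ∨ X c.2.var = c.2.sign

/-- The variable `x_{i,e}` says that vertex `i` is adjacent to the extra vertex `e`
(`e = 0, 1` being the extra vertices number `n + 1` and `n + 2`). -/
abbrev EdgeVar (n : ℕ) : Type := Fin n × Fin 2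

def pos {n : ℕ} (i : Fin n) (e : Fin 2) : Literal (EdgeVar n) := ⟨(i, e), true⟩

def neg {n : ℕ} (i : Fin n) (e : Fin 2) : Literal (EdgeVar n) := ⟨(i, e), false⟩

/-- The formula `φ₂`. The graph `G_D` is the unweighted 1-skeleton of `D`. For `D i j = 2` and
`d_{G_D}(i, j) > 2` the four clauses are the conjunctive normal form of
`(x_{i,0} ∧ x_{j,0}) ∨ (x_{i,1} ∧ x_{j,1})`. -/
def phi₂ {n : ℕ} (D : Matrix (Fin n) (Fin n) ℕ) : TwoCNF (EdgeVar n) :=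
  {c | ∃ i j, 2 < D i j ∧ (c = (neg i 0, neg j 0) ∨ c = (neg i 1, neg j 1))} ∪
  {c | ∃ i j, D i j = 2 ∧ 2 < (skeleton D 1).edist i j ∧
    (c = (pos i 0, pos i 1) ∨ c = (pos j 0, pos j 1) ∨
      c = (pos i 0, pos j 1) ∨ c = (pos i 1, pos j 0))}

/-- The formula `φ₂′`. For `D i j = 3` and `D^(2) i j > 3` the four clauses are the conjunctive
normal form of `(x_{i,0} ∧ x_{j,1}) ∨ (x_{i,1} ∧ x_{j,0})`. -/
def phi₂' {n : ℕ} (D : Matrix (Fin n) (Fin n) ℕ) : TwoCNF (EdgeVar n) :=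
  phi₂ D ∪
  {c | ∃ i j, 3 < D i j ∧ (c = (neg i 0, neg j 1) ∨ c = (neg i 1, neg j 0))} ∪
  {c | ∃ i j, D i j = 3 ∧ 3 < skeletonDist D 2 i j ∧
    (c = (pos i 0, pos i 1) ∨ c = (pos j 0, pos j 1) ∨
      c = (pos i 0, pos j 0) ∨ c = (pos i 1, pos j 1))}

/-! ### Candidate graphs

The `n + 2` vertices are `Sum.inl i` for `i : Fin n` (the images of the indices) and the two extra
vertices `Sum.inr 0` and `Sum.inr 1`. -/

/-- The graph with induced subgraph `G_D` on the first `n` vertices, with the edges to the extra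
vertices prescribed by `X`, and with an edge between the two extra vertices iff `b`. -/
def candidate {n : ℕ} (D : Matrix (Fin n) (Fin n) ℕ) (X : EdgeVar n → Bool) (b : Prop) :
    SimpleGraph (Fin n ⊕ Fin 2) where
  Adj
    | .inl i, .inl j => (skeleton D 1).Adj i j
    | .inl i, .inr e => X (i, e) = true
    | .inr e, .inl i => X (i, e) = true
    | .inr e, .inr e' => e ≠ e' ∧ b
  symm := ⟨by
    rintro (i | e) (j | e') h
    · exact h.symm
    · exact h
    · exact h
    · exact ⟨h.1.symm, h.2⟩⟩
  loopless := ⟨by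
    rintro (i | e) h
    · exact (skeleton D 1).loopless.irrefl i h
    · exact h.1 rfl⟩

/-! ### Instances and outputs as words -/

/-- Problem instances: square matrices with non-negative integer entries. -/
abbrev Instance : Type := Σ n : ℕ, Matrix (Fin n) (Fin n) ℕ

/-- The word of an instance: its rows in order, each between `bra` and `ket`; each entry is a
`comma` followed by its binary digits. -/
def encodeInstance (I : Instance) : List Γ' :=
  (List.finRange I.1).flatMap fun i =>
    Γ'.bra :: (((List.finRange I.1).flatMap fun j =>
      Γ'.comma :: (encodeNat (I.2 i j)).map Γ'.bit) ++ [Γ'.ket])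

/-- Outputs: either "no realisation" (`none`), or a graph on `n + 2` vertices. -/
abbrev Output : Type := Option (Σ n : ℕ, SimpleGraph (Fin n ⊕ Fin 2))

/-- The vertices `1, …, n, n + 1, n + 2` in order. -/
def vertexList (n : ℕ) : List (Fin n ⊕ Fin 2) :=
  (List.finRange n).map Sum.inl ++ [Sum.inr 0, Sum.inr 1]

open Classical in
/-- The word of an output: a bit telling whether there is a graph, and then the rows of the
adjacency matrix of the graph in order, each between `bra` and `ket`. -/
noncomputable def encodeOutput : Output → List Γ'
  | none => [Γ'.bit false]
  | some ⟨n, G⟩ => Γ'.bit true :: (vertexList n).flatMap fun u =>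
      Γ'.bra :: ((vertexList n).map (fun v => Γ'.bit (decide (G.Adj u v))) ++ [Γ'.ket])

/-! The two encodings are unambiguous. -/

theorem word_ext {s : Γ'} {a b r t : List Γ'} (ha : s ∉ a) (hb : s ∉ b)
    (hr : r.head? = none ∨ r.head? = some s) (ht : t.head? = none ∨ t.head? = some s)
    (h : a ++ r = b ++ t) : a = b ∧ r = t := by
  induction a generalizing b with
  | nil =>
    cases b with
    | nil => exact ⟨rfl, by simpa using h⟩
    | cons y b =>
      simp only [List.nil_append, List.cons_append] at h
      subst h
      rcases hr with hr | hr
      · simp at hr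
      · rw [List.head?_cons, Option.some.injEq] at hr
        exact absurd (hr ▸ List.mem_cons_self) hb
  | cons x a ih =>
    cases b with
    | nil =>
      simp only [List.nil_append, List.cons_append] at h
      subst h
      rcases ht with ht | ht
      · simp at ht
      · rw [List.head?_cons, Option.some.injEq] at ht
        exact absurd (ht ▸ List.mem_cons_self) ha
    | cons y b =>
      simp only [List.cons_append, List.cons.injEq] at h
      obtain ⟨h1, h2⟩ := ih (b := b) (by simp_all) (by simp_all) h.2
      exact ⟨by rw [h.1, h1], h2⟩

theorem flatMap_ext {ι : Type} {s : Γ'} {L : List ι} {f g : ι → List Γ'} (hf : ∀ i, s ∉ f i)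
    (hg : ∀ i, s ∉ g i) (h : (L.flatMap fun i => s :: f i) = L.flatMap fun i => s :: g i) :
    ∀ i ∈ L, f i = g i := by
  have head (u : ι → List Γ') (L : List ι) : (L.flatMap fun i => s :: u i).head? = none ∨
      (L.flatMap fun i => s :: u i).head? = some s := by cases L <;> simp
  induction L with
  | nil => simp
  | cons a L ih =>
    simp only [List.flatMap_cons, List.cons_append, List.cons.injEq, true_and] at h
    obtain ⟨h1, h2⟩ := word_ext (hf a) (hg a) (head f L) (head g L) h
    intro i hi
    rcases List.mem_cons.1 hi with rfl | hi
    · exact h1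
    · exact ih h2 i hi

theorem count_flatMap {ι : Type} {s : Γ'} {f : ι → List Γ'} (hf : ∀ i, s ∉ f i) (L : List ι) :
    (L.flatMap fun i => s :: f i).count s = L.length := by
  induction L with
  | nil => simp
  | cons a L ih =>
    simp only [List.flatMap_cons, List.count_append, List.count_cons_self, List.length_cons, ih,
      List.count_eq_zero_of_not_mem (hf a)]
    omega

theorem encodeInstance_injective : Function.Injective encodeInstance := by
  rintro ⟨n, D⟩ ⟨m, E⟩ h
  have hbra (k : ℕ) (F : Matrix (Fin k) (Fin k) ℕ) (i : Fin k) :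
      Γ'.bra ∉ ((List.finRange k).flatMap fun j =>
        Γ'.comma :: (encodeNat (F i j)).map Γ'.bit) ++ [Γ'.ket] := by simp
  have hc := congrArg (List.count Γ'.bra) h
  simp only [encodeInstance, count_flatMap (hbra n D), count_flatMap (hbra m E),
    List.length_finRange] at hc
  subst hc
  congr 1
  ext i j
  have h1 := flatMap_ext (hbra n D) (hbra n E) h i (List.mem_finRange i)
  have h2 := flatMap_ext (by simp) (by simp) (List.append_cancel_right h1) j (List.mem_finRange j)
  have h3 := List.map_injective_iff.2 (fun a b hab => by simpa using hab) h2
  rw [← decode_encodeNat (D i j), h3, decode_encodeNat]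

theorem mem_vertexList {n : ℕ} (u : Fin n ⊕ Fin 2) : u ∈ vertexList n := by
  rcases u with i | e
  · simp [vertexList]
  · fin_cases e <;> simp [vertexList]

theorem encodeOutput_injective : Function.Injective encodeOutput := by
  classical
  rintro (_ | ⟨n, G⟩) (_ | ⟨m, H⟩) h
  · rfl
  · simp [encodeOutput] at h
  · simp [encodeOutput] at h
  · have hbra (k : ℕ) (F : SimpleGraph (Fin k ⊕ Fin 2)) (u : Fin k ⊕ Fin 2) :
        Γ'.bra ∉ (vertexList k).map (fun v => Γ'.bit (decide (F.Adj u v))) ++ [Γ'.ket] := by simp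
    simp only [encodeOutput, List.cons.injEq, true_and] at h
    have hc := congrArg (List.count Γ'.bra) h
    rw [count_flatMap (hbra n G), count_flatMap (hbra m H)] at hc
    obtain rfl : n = m := by simpa [vertexList] using hc
    congr 2
    ext u v
    have h1 := List.append_cancel_right (flatMap_ext (hbra n G) (hbra n H) h u (mem_vertexList u))
    have h2 := List.map_inj_left.1 h1 v (mem_vertexList v)
    simpa using h2

end CombDMR

/-!
The theorem has a graph-theoretical and a computational part.

**Graphs.** Let `D` be a distance matrix and let `X` satisfy `φ₂`. An edge `{i, k}` of the
`2`-skeleton of length two either has a middle vertex in the `1`-skeleton, or the formula provides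
an extra vertex adjacent to both ends; hence distances in the candidate graph are at most the
skeleton distances (`edist_le_two_of_satisfies`). Conversely a walk in the candidate graph can be
cut at the extra vertices, and the negative clauses say that a detour `i - e - k` only occurs for
`D i k ≤ 2` (`candidate_walk_bound`). The same reasoning with edges of length three and detours
`i - e - e' - k` works for `φ₂′` and the `3`-skeleton. Every realisation on `Fin n ⊕ Fin 2` is the
candidate graph of the assignment that reads off its adjacencies (`eq_candidate`), and this
assignment satisfies the formula, because a shortest path of length two or three between indices
that is not accounted for by the skeleton runs through extra vertices only. A realisation with
fewer extra vertices is completed by isolated vertices (`exists_embedding`). So `D` is a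
YES-instance iff, for one of the two formulas, the formula is satisfiable and `D` equals the
skeleton distances (`exists_isRealisation_iff`).

**The algorithm.** The entries of `D` may be exponentially large in the length of the input, so
skeleton distances are never computed. Instead, that `D` is a distance matrix and equals the
distance matrix of its `q`-skeleton is tested by a local condition: it suffices to check the
triangle inequality for triangles with a side of length at most `q`, and that for `D i j > q` some
edge of the skeleton at `i` leads towards `j` (`isSkeletalMatrix_iff`). It only has to be
recognised which numerals differ by at most three. The premises of the clauses are equally local.
Satisfiability of a 2-CNF formula is decided, and a satisfying assignment found, by the transitive
closure of the implication graph (`TwoSat.solved_of_satisfiable`).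

**Polynomial time.** Structured programs on stacks are compiled to `TM2` machines
(`StackProg.Prog.Runs.simulates`). Their data are binary trees, stored on one stack in preorder. A
function is in the class `PT` if such a program computes it in polynomial time, including a
polynomial bound for the size of the result. The class is closed under composition, pairing, case
distinction and bounded iteration (`PT.whileLoop`), hence under the usual list operations, so that
membership of the algorithm follows from the shape of its definition. With programs for reading
the input and writing the output, functions in `PT` become polynomial-time machines
(`PT.exists_machine`), for which any polynomial may be added to the time bound. The decision
machine and the construction machine both get the sum of their bounds.
-/

/-! ### Structured stack programs and their compilation to `TM2` machines -/

namespace StackProg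

open Turing Function

variable {K : Type} {Γ : K → Type}

/-- Structured programs acting on a family of stacks. The tests of `ite` and `loop` look at the top
of one stack; `loop` is a while loop. -/
inductive Prog (Γ : K → Type) : Type
  | skip : Prog Γ
  | push (k : K) (a : Γ k) : Prog Γ
  | pop (k : K) : Prog Γ
  | seq (p q : Prog Γ) : Prog Γ
  | ite (k : K) (c : Option (Γ k) → Bool) (p q : Prog Γ) : Prog Γ
  | loop (k : K) (c : Option (Γ k) → Bool) (p : Prog Γ) : Prog Γ

namespace Prog

/-- The control points of a program. -/
def Lab : Prog Γ → Type
  | skip => Unit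
  | push _ _ => Unit
  | pop _ => Unit
  | seq p q => Lab p ⊕ Lab q
  | ite _ _ p q => Option (Lab p ⊕ Lab q)
  | loop _ _ p => Option (Lab p)

/-- The control point at which the execution of a program starts. -/
def entry : (p : Prog Γ) → Lab p
  | skip => ()
  | push _ _ => ()
  | pop _ => ()
  | seq p _ => Sum.inl (entry p)
  | ite _ _ _ _ => none
  | loop _ _ _ => none

theorem finite_lab (p : Prog Γ) : Finite (Lab p) := by
  induction p with
  | skip => exact inferInstanceAs (Finite Unit)
  | push => exact inferInstanceAs (Finite Unit)
  | pop => exact inferInstanceAs (Finite Unit)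
  | seq p q hp hq => exact inferInstanceAs (Finite (Lab p ⊕ Lab q))
  | ite k c p q hp hq => exact inferInstanceAs (Finite (Option (Lab p ⊕ Lab q)))
  | loop k c p hp => exact inferInstanceAs (Finite (Option (Lab p)))

/-- A conditional jump. The internal state of the machine only holds the outcome of the test, and it
is reset to `false` before the jump. -/
def test {Λ : Type} (k : K) (c : Option (Γ k) → Bool) (l₁ l₂ : Λ) : TM2.Stmt Γ Λ Bool :=
  .peek k (fun _ o => c o) (.branch id (.load (fun _ => false) (.goto fun _ => l₁))
    (.load (fun _ => false) (.goto fun _ => l₂)))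

/-- The `TM2` statements of a program whose control points are embedded by `emb` into the labels of
a machine, and which jumps to the label `exit` when it is done. -/
def code {Λ : Type} : (p : Prog Γ) → (emb : Lab p → Λ) → (exit : Λ) → Lab p → TM2.Stmt Γ Λ Bool
  | skip, _, exit, _ => .goto fun _ => exit
  | push k a, _, exit, _ => .push k (fun _ => a) (.goto fun _ => exit)
  | pop k, _, exit, _ => .pop k (fun s _ => s) (.goto fun _ => exit)
  | seq p q, emb, exit, l => match l with
    | .inl l => code p (emb ∘ Sum.inl) (emb (Sum.inr (entry q))) l
    | .inr l => code q (emb ∘ Sum.inr) exit l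
  | ite k c p q, emb, exit, l => match l with
    | none => test k c (emb (some (Sum.inl (entry p)))) (emb (some (Sum.inr (entry q))))
    | some (.inl l) => code p (emb ∘ some ∘ Sum.inl) exit l
    | some (.inr l) => code q (emb ∘ some ∘ Sum.inr) exit l
  | loop k c p, emb, exit, l => match l with
    | none => test k c (emb (some (entry p))) exit
    | some l => code p (emb ∘ some) (emb none) l

variable [DecidableEq K]

/-- `Runs p S S' t`: the program `p` leads from the stacks `S` to the stacks `S'` in `t` steps. -/
inductive Runs : Prog Γ → (∀ k, List (Γ k)) → (∀ k, List (Γ k)) → ℕ → Prop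
  | skip (S) : Runs skip S S 1
  | push (k a S) : Runs (push k a) S (update S k (a :: S k)) 1
  | pop (k S) : Runs (pop k) S (update S k (S k).tail) 1
  | seq {p q S S' S'' t u} : Runs p S S' t → Runs q S' S'' u → Runs (seq p q) S S'' (u + t)
  | ite_true {k c p q S S' t} : c (S k).head? = true → Runs p S S' t →
      Runs (ite k c p q) S S' (t + 1)
  | ite_false {k c p q S S' t} : c (S k).head? = false → Runs q S S' t →
      Runs (ite k c p q) S S' (t + 1)
  | loop_done {k c p S} : c (S k).head? = false → Runs (loop k c p) S S 1
  | loop_step {k c p S S' S'' t u} : c (S k).head? = true → Runs p S S' t →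
      Runs (loop k c p) S' S'' u → Runs (loop k c p) S S'' (u + t + 1)

theorem step_test {Λ : Type} {M : Λ → TM2.Stmt Γ Λ Bool} {k : K} {c : Option (Γ k) → Bool}
    {l l₁ l₂ : Λ} (h : M l = test k c l₁ l₂) (S : ∀ k, List (Γ k)) :
    TM2.step M ⟨some l, false, S⟩ = some ⟨some (bif c (S k).head? then l₁ else l₂), false, S⟩ := by
  rw [TM2.step, h, test]
  cases hc : c (S k).head? <;> simp [hc]

/-- Any machine that contains the statements of a program simulates the runs of the program. -/
theorem Runs.simulates {p : Prog Γ} {S S' : ∀ k, List (Γ k)} {t : ℕ} (h : Runs p S S' t)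
    {Λ : Type} (M : Λ → TM2.Stmt Γ Λ Bool) (emb : Lab p → Λ) (exit : Λ)
    (hM : ∀ l, M (emb l) = code p emb exit l) :
    (flip bind (TM2.step M))^[t] (some ⟨some (emb (entry p)), false, S⟩) =
      some ⟨some exit, false, S'⟩ := by
  induction h generalizing exit with
  | skip S =>
    change TM2.step M ⟨some (emb _), false, S⟩ = _
    rw [TM2.step, hM]; rfl
  | push k a S =>
    change TM2.step M ⟨some (emb _), false, S⟩ = _
    rw [TM2.step, hM]; rfl
  | pop k S =>
    change TM2.step M ⟨some (emb _), false, S⟩ = _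
    rw [TM2.step, hM]; rfl
  | seq h₁ h₂ ih₁ ih₂ =>
    rw [iterate_add_apply]
    erw [ih₁ (emb ∘ Sum.inl) (emb (Sum.inr (entry _))) fun l => hM (Sum.inl l)]
    exact ih₂ (emb ∘ Sum.inr) exit fun l => hM (Sum.inr l)
  | @ite_true k c p q S S' t hc h ih =>
    rw [iterate_succ_apply]
    change (flip bind (TM2.step M))^[t] (TM2.step M ⟨some (emb none), false, S⟩) = _
    rw [step_test (hM none), hc]
    exact ih (emb ∘ some ∘ Sum.inl) exit fun l => hM (some (Sum.inl l))
  | @ite_false k c p q S S' t hc h ih =>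
    rw [iterate_succ_apply]
    change (flip bind (TM2.step M))^[t] (TM2.step M ⟨some (emb none), false, S⟩) = _
    rw [step_test (hM none), hc]
    exact ih (emb ∘ some ∘ Sum.inr) exit fun l => hM (some (Sum.inr l))
  | @loop_done k c p S hc =>
    change TM2.step M ⟨some (emb none), false, S⟩ = _
    rw [step_test (hM none), hc]; rfl
  | @loop_step k c p S S' S'' t u hc h₁ h₂ ih₁ ih₂ =>
    rw [iterate_succ_apply]
    change (flip bind (TM2.step M))^[u + t] (TM2.step M ⟨some (emb none), false, S⟩) = _
    rw [step_test (hM none), hc, iterate_add_apply]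
    erw [ih₁ (emb ∘ some) (emb none) fun l => hM (some l)]
    exact ih₂ emb exit hM

/-- `RunsIn p S S' t`: the program `p` leads from `S` to `S'` in at most `t` steps. -/
def RunsIn (p : Prog Γ) (S S' : ∀ k, List (Γ k)) (t : ℕ) : Prop :=
  ∃ u ≤ t, Runs p S S' u

namespace RunsIn

variable {p q : Prog Γ} {S S' S'' : ∀ k, List (Γ k)} {t u : ℕ} {k : K} {c : Option (Γ k) → Bool}

theorem mono (h : RunsIn p S S' t) (htu : t ≤ u) : RunsIn p S S' u :=
  let ⟨v, hv, h⟩ := h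
  ⟨v, hv.trans htu, h⟩

theorem of_eq (h : RunsIn p S S' t) (hS : S' = S'') (htu : t ≤ u) : RunsIn p S S'' u :=
  hS ▸ h.mono htu

theorem skip (S : ∀ k, List (Γ k)) : RunsIn .skip S S 1 := ⟨1, le_rfl, .skip S⟩

theorem push (k : K) (a : Γ k) (h : update S k (a :: S k) = S') : RunsIn (.push k a) S S' 1 :=
  ⟨1, le_rfl, h ▸ .push k a S⟩

theorem pop (k : K) (h : update S k (S k).tail = S') : RunsIn (.pop k) S S' 1 :=
  ⟨1, le_rfl, h ▸ .pop k S⟩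

theorem seq (h₁ : RunsIn p S S' t) (h₂ : RunsIn q S' S'' u) :
    RunsIn (.seq p q) S S'' (t + u) := by
  obtain ⟨t', ht, h₁⟩ := h₁
  obtain ⟨u', hu, h₂⟩ := h₂
  exact ⟨u' + t', by omega, h₁.seq h₂⟩

theorem ite_true (hc : c (S k).head? = true) (h : RunsIn p S S' t) :
    RunsIn (.ite k c p q) S S' (t + 1) := by
  obtain ⟨t', ht, h⟩ := h
  exact ⟨t' + 1, by omega, .ite_true hc h⟩

theorem ite_false (hc : c (S k).head? = false) (h : RunsIn q S S' t) :
    RunsIn (.ite k c p q) S S' (t + 1) := by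
  obtain ⟨t', ht, h⟩ := h
  exact ⟨t' + 1, by omega, .ite_false hc h⟩

theorem loop_done (hc : c (S k).head? = false) : RunsIn (.loop k c p) S S 1 :=
  ⟨1, le_rfl, .loop_done hc⟩

theorem loop_step (hc : c (S k).head? = true) (h₁ : RunsIn p S S' t)
    (h₂ : RunsIn (.loop k c p) S' S'' u) : RunsIn (.loop k c p) S S'' (t + u + 1) := by
  obtain ⟨t', ht, h₁⟩ := h₁
  obtain ⟨u', hu, h₂⟩ := h₂
  exact ⟨u' + t' + 1, by omega, .loop_step hc h₁ h₂⟩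

end RunsIn

/-- The machine that executes the program `p` and halts. -/
noncomputable def machine [Fintype K] (p : Prog Γ) (k₀ k₁ : K) [Fintype (Γ k₀)] : FinTM2 where
  K := K
  k₀ := k₀
  k₁ := k₁
  Γ := Γ
  Λ := Option (Lab p)
  main := some (entry p)
  ΛFin := @Fintype.ofFinite _ (@instFiniteOption _ (finite_lab p))
  σ := Bool
  initialState := false
  m
    | none => .halt
    | some l => code p some none l

theorem dite_eq_update (k₀ : K) (l : List (Γ k₀)) (k : K) :
    (if h : k = k₀ then (by rw [h]; exact l : List (Γ k)) else []) =
      update (fun _ => []) k₀ l k := by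
  by_cases hk : k = k₀
  · subst hk
    simp
  · simp [hk]

/-- The time bound for the machine has one more step than the program, for halting. -/
theorem RunsIn.machine_outputs [Fintype K] {p : Prog Γ} {k₀ k₁ : K} [Fintype (Γ k₀)]
    {l : List (Γ k₀)} {l' : List (Γ k₁)} {t : ℕ}
    (h : RunsIn p (update (fun _ => []) k₀ l) (update (fun _ => []) k₁ l') t) :
    Nonempty (TM2OutputsInTime (machine p k₀ k₁) l (some l') (t + 1)) := by
  obtain ⟨u, hu, h⟩ := h
  have h := h.simulates (machine p k₀ k₁).m some none fun _ => rfl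
  have hi : initList (machine p k₀ k₁) l =
      ⟨some (some (entry p)), false, update (fun _ => []) k₀ l⟩ :=
    congrArg (TM2.Cfg.mk _ _) (funext (dite_eq_update k₀ l))
  have hf : haltList (machine p k₀ k₁) l' = ⟨none, false, update (fun _ => []) k₁ l'⟩ :=
    congrArg (TM2.Cfg.mk _ _) (funext (dite_eq_update k₁ l'))
  refine ⟨⟨⟨u + 1, ?_⟩, Nat.succ_le_succ hu⟩⟩
  rw [iterate_succ_apply', hi]
  erw [h]
  exact congrArg some hf.symm

end Prog

end StackProg

/-! ### Binary trees on a stack -/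

namespace StackProg

open Turing Function Computability Prog

/-- Binary trees with unlabelled leaves and nodes, the data type of the stack programs below. -/
inductive DTree : Type
  | leaf : DTree
  | node (a b : DTree) : DTree

namespace DTree

/-- The preorder word of a tree: `true` for a node and `false` for a leaf. -/
def word : DTree → List Bool
  | leaf => [false]
  | node a b => true :: (word a ++ word b)

/-- The left subtree; the left subtree of a leaf is a leaf. -/
def left : DTree → DTree
  | leaf => leaf
  | node a _ => a

/-- The right subtree; the right subtree of a leaf is a leaf. -/
def right : DTree → DTree
  | leaf => leaf
  | node _ b => b

/-- Truth values are represented by the leaf (false) and the smallest node (true). -/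
def ofBool : Bool → DTree
  | false => leaf
  | true => node leaf leaf

/-- Whether the tree is a node. -/
def isNode : DTree → Bool
  | leaf => false
  | node _ _ => true

/-- The preorder word is a prefix code. -/
theorem word_append_inj {s t : DTree} {u v : List Bool} (h : word s ++ u = word t ++ v) :
    s = t ∧ u = v := by
  induction s generalizing t u v with
  | leaf => cases t <;> simp_all [word]
  | node a b iha ihb =>
    cases t with
    | leaf => simp [word] at h
    | node c d =>
      simp only [word, List.cons_append, List.append_assoc, List.cons.injEq, true_and] at h
      obtain ⟨rfl, h'⟩ := iha h
      obtain ⟨rfl, rfl⟩ := ihb h'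
      exact ⟨rfl, rfl⟩

theorem word_injective : Injective word := fun s t h =>
  (word_append_inj (u := []) (v := []) (by rw [h])).1

/-- The number of nodes and leaves. -/
def size (t : DTree) : ℕ := (word t).length

theorem length_word (t : DTree) : t.word.length = t.size := rfl

@[simp] theorem size_leaf : size leaf = 1 := rfl

@[simp] theorem size_node (a b : DTree) : size (node a b) = size a + size b + 1 := by
  simp [size, word]

end DTree

/-- The stacks: one for the input, one for the output, the main stack `dat` holding a sequence of
preorder words of trees, two auxiliary stacks, and a counter. -/
inductive Reg : Type
  | inp | out | dat | aux₁ | aux₂ | cnt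
  deriving DecidableEq

instance : Fintype Reg where
  elems := {.inp, .out, .dat, .aux₁, .aux₂, .cnt}
  complete k := by cases k <;> decide

/-- The stack alphabets, for the output alphabet `O`. -/
def Sym (O : Type) : Reg → Type
  | .inp => Γ'
  | .out => O
  | .dat => Bool
  | .aux₁ => Bool
  | .aux₂ => Bool
  | .cnt => Bool

variable {O : Type}

/-- The stacks with given contents. -/
def st (i : List Γ') (o : List O) (a b c n : List Bool) : ∀ k, List (Sym O k)
  | .inp => i
  | .out => o
  | .dat => a
  | .aux₁ => b
  | .aux₂ => c
  | .cnt => n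

section st

variable (i i' : List Γ') (o o' : List O) (a b c n w : List Bool)

theorem st_inp : update (st i o a b c n) .inp i' = st i' o a b c n := by
  funext k; cases k <;> rfl

theorem st_out : update (st i o a b c n) .out o' = st i o' a b c n := by
  funext k; cases k <;> rfl

theorem st_dat : update (st i o a b c n) .dat w = st i o w b c n := by
  funext k; cases k <;> rfl

theorem st_aux₁ : update (st i o a b c n) .aux₁ w = st i o a w c n := by
  funext k; cases k <;> rfl

theorem st_aux₂ : update (st i o a b c n) .aux₂ w = st i o a b w n := by
  funext k; cases k <;> rfl

theorem st_cnt : update (st i o a b c n) .cnt w = st i o a b c w := by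
  funext k; cases k <;> rfl

variable (s : Bool)

theorem pop_dat : RunsIn (.pop .dat) (st i o (s :: a) b c n) (st i o a b c n) 1 :=
  .pop _ (st_dat ..)

theorem pop_aux₁ : RunsIn (.pop .aux₁) (st i o a (s :: b) c n) (st i o a b c n) 1 :=
  .pop _ (st_aux₁ ..)

theorem pop_aux₂ : RunsIn (.pop .aux₂) (st i o a b c n) (st i o a b c.tail n) 1 :=
  .pop _ (st_aux₂ ..)

theorem pop_cnt : RunsIn (.pop .cnt) (st i o a b c (s :: n)) (st i o a b c n) 1 :=
  .pop _ (st_cnt ..)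

theorem push_dat : RunsIn (.push .dat s) (st i o a b c n) (st i o (s :: a) b c n) 1 :=
  .push _ _ (st_dat ..)

theorem push_aux₁ : RunsIn (.push .aux₁ s) (st i o a b c n) (st i o a (s :: b) c n) 1 :=
  .push _ _ (st_aux₁ ..)

theorem push_aux₂ : RunsIn (.push .aux₂ s) (st i o a b c n) (st i o a b (s :: c) n) 1 :=
  .push _ _ (st_aux₂ ..)

theorem push_cnt : RunsIn (.push .cnt s) (st i o a b c n) (st i o a b c (s :: n)) 1 :=
  .push _ _ (st_cnt ..)

end st

/-- Whether the top of a stack of truth values is `s`. -/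
def topIs (s : Bool) (o : Option Bool) : Bool := o == some s

/-- Copy a symbol to the auxiliary stacks selected by `u` and `v`. -/
def put (O : Type) (u v s : Bool) : Prog (Sym O) :=
  .seq (bif u then .push .aux₁ s else .skip) (bif v then .push .aux₂ s else .skip)

theorem put_runs (u v s : Bool) (i : List Γ') (o : List O) (a b c n : List Bool) :
    RunsIn (put O u v s) (st i o a b c n)
      (st i o a (bif u then s :: b else b) (bif v then s :: c else c) n) 2 := by
  refine RunsIn.seq (t := 1) (u := 1) (S' := st i o a (bif u then s :: b else b) c n) ?_ ?_
  · cases u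
    · exact .skip _
    · exact push_aux₁ ..
  · cases v
    · exact .skip _
    · exact push_aux₂ ..

/-- Move symbols from `dat` to the selected auxiliary stacks, until the counter, which is the number
of trees still to be moved, is zero. -/
def moveLoop (O : Type) (u v : Bool) : Prog (Sym O) :=
  .loop .cnt Option.isSome (.ite .dat (topIs true)
    (.seq (.pop .dat) (.seq (put O u v true) (.push .cnt true)))
    (.seq (.pop .dat) (.seq (put O u v false) (.pop .cnt))))

/-- Remove the topmost tree of `dat`, and put its reversed word on the selected auxiliary stacks. -/
def moveTree (O : Type) (u v : Bool) : Prog (Sym O) :=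
  .seq (.push .cnt true) (moveLoop O u v)

/-- The content of an auxiliary stack after `w` has been moved there, if `u` is true. -/
def moved (u : Bool) (w b : List Bool) : List Bool := bif u then w.reverse ++ b else b

/-- While a tree is moved, a node increases the counter of trees still to be moved, and a leaf
decreases it. The statement is in continuation form, for an induction over the tree. -/
theorem moveLoop_runs (u v : Bool) (t : DTree) {i : List Γ'} {o : List O} {a b c n : List Bool}
    {S : ∀ k, List (Sym O k)} {m : ℕ}
    (h : RunsIn (moveLoop O u v) (st i o a (moved u t.word b) (moved v t.word c) n) S m) :
    RunsIn (moveLoop O u v) (st i o (t.word ++ a) b c (true :: n)) S (6 * t.size + m) := by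
  induction t generalizing a b c n m with
  | leaf =>
    refine (RunsIn.loop_step (t := 5) (u := m) rfl (S' := st i o a (moved u [false] b)
      (moved v [false] c) n) (RunsIn.ite_false rfl ?_) h).mono (by simp)
    exact RunsIn.seq (t := 1) (u := 3) (pop_dat ..)
      (RunsIn.seq (t := 2) (u := 1) (put_runs ..) (by cases u <;> cases v <;> exact pop_cnt ..))
  | node s t ihs iht =>
    refine (RunsIn.loop_step (t := 5) (u := 6 * s.size + (6 * t.size + m)) rfl
      (S' := st i o (s.word ++ (t.word ++ a)) (moved u [true] b) (moved v [true] c)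
      (true :: true :: n)) (RunsIn.ite_true rfl ?_) (ihs (iht ?_))).mono (by simp; omega)
    · rw [DTree.word, List.cons_append, List.append_assoc]
      exact RunsIn.seq (t := 1) (u := 3) (pop_dat ..)
        (RunsIn.seq (t := 2) (u := 1) (put_runs ..)
          (by cases u <;> cases v <;> exact push_cnt ..))
    · convert h using 2 <;> cases u <;> cases v <;> simp [moved, DTree.word]

theorem moveTree_runs (u v : Bool) (t : DTree) (i : List Γ') (o : List O) (a b c : List Bool) :
    RunsIn (moveTree O u v) (st i o (t.word ++ a) b c [])
      (st i o a (moved u t.word b) (moved v t.word c) []) (6 * t.size + 2) :=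
  (RunsIn.seq (t := 1) (push_cnt ..) (moveLoop_runs u v t (.loop_done rfl))).mono
    (by omega)

/-- Move the whole first auxiliary stack back to `dat`. -/
def flush₁ (O : Type) : Prog (Sym O) :=
  .loop .aux₁ Option.isSome (.ite .aux₁ (topIs true) (.seq (.pop .aux₁) (.push .dat true))
    (.seq (.pop .aux₁) (.push .dat false)))

/-- Move the whole second auxiliary stack back to `dat`. -/
def flush₂ (O : Type) : Prog (Sym O) :=
  .loop .aux₂ Option.isSome (.ite .aux₂ (topIs true) (.seq (.pop .aux₂) (.push .dat true))
    (.seq (.pop .aux₂) (.push .dat false)))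

theorem flush₁_runs (i : List Γ') (o : List O) (a b c n : List Bool) :
    RunsIn (flush₁ O) (st i o a b c n) (st i o (b.reverse ++ a) [] c n) (4 * b.length + 1) := by
  induction b generalizing a with
  | nil => exact .loop_done rfl
  | cons s b ih =>
    have h := ih (s :: a)
    simp only [List.reverse_cons, List.append_assoc, List.singleton_append]
    refine (RunsIn.loop_step (t := 3) rfl ?_ h).mono (by simp; omega)
    cases s
    · exact .ite_false rfl (RunsIn.seq (t := 1) (u := 1) (pop_aux₁ ..)
        (push_dat ..))
    · exact .ite_true rfl (RunsIn.seq (t := 1) (u := 1) (pop_aux₁ ..)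
        (push_dat ..))

theorem flush₂_runs (i : List Γ') (o : List O) (a b c n : List Bool) :
    RunsIn (flush₂ O) (st i o a b c n) (st i o (c.reverse ++ a) b [] n) (4 * c.length + 1) := by
  induction c generalizing a with
  | nil => exact .loop_done rfl
  | cons s c ih =>
    have h := ih (s :: a)
    simp only [List.reverse_cons, List.append_assoc, List.singleton_append]
    refine (RunsIn.loop_step (t := 3) rfl ?_ h).mono (by simp; omega)
    cases s
    · exact .ite_false rfl (RunsIn.seq (t := 1) (u := 1) (pop_aux₂ ..)
        (push_dat ..))
    · exact .ite_true rfl (RunsIn.seq (t := 1) (u := 1) (pop_aux₂ ..)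
        (push_dat ..))

/-- Duplicate the topmost tree. -/
def dup (O : Type) : Prog (Sym O) := .seq (moveTree O true true) (.seq (flush₁ O) (flush₂ O))

theorem dup_runs (t : DTree) (i : List Γ') (o : List O) (a : List Bool) :
    RunsIn (dup O) (st i o (t.word ++ a) [] [] []) (st i o (t.word ++ (t.word ++ a)) [] [] [])
      (14 * t.size + 4) := by
  refine ((moveTree_runs true true t i o a [] []).seq
    ((flush₁_runs ..).seq (flush₂_runs ..))).of_eq ?_ ?_
  · simp [moved]
  · simp [moved, DTree.length_word]; omega

/-- Exchange the two topmost trees. -/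
def exchange (O : Type) : Prog (Sym O) :=
  .seq (moveTree O true false) (.seq (moveTree O false true) (.seq (flush₁ O) (flush₂ O)))

theorem exchange_runs (s t : DTree) (i : List Γ') (o : List O) (a : List Bool) :
    RunsIn (exchange O) (st i o (s.word ++ (t.word ++ a)) [] [] [])
      (st i o (t.word ++ (s.word ++ a)) [] [] []) (10 * s.size + 10 * t.size + 6) := by
  refine ((moveTree_runs true false s i o _ [] []).seq ((moveTree_runs false true t i o a _ _).seq
    ((flush₁_runs ..).seq (flush₂_runs ..)))).of_eq ?_ ?_
  · simp [moved]
  · simp [moved, DTree.length_word]; omega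

/-- Replace the topmost tree by its right subtree. -/
def toRight (O : Type) : Prog (Sym O) :=
  .ite .dat (topIs true) (.seq (.pop .dat) (moveTree O false false)) .skip

theorem toRight_runs (t : DTree) (i : List Γ') (o : List O) (a : List Bool) :
    RunsIn (toRight O) (st i o (t.word ++ a) [] [] []) (st i o (t.right.word ++ a) [] [] [])
      (6 * t.size + 4) := by
  cases t with
  | leaf => exact (RunsIn.ite_false rfl (.skip _)).mono (by omega)
  | node s t =>
    rw [DTree.word, List.cons_append, List.append_assoc]
    exact (RunsIn.ite_true rfl ((pop_dat ..).seq
      (moveTree_runs false false s i o (t.word ++ a) [] []))).of_eq rfl (by simp; omega)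

/-- Replace the topmost tree by its left subtree. -/
def toLeft (O : Type) : Prog (Sym O) :=
  .ite .dat (topIs true) (.seq (.pop .dat) (.seq (moveTree O true false)
    (.seq (moveTree O false false) (flush₁ O)))) .skip

theorem toLeft_runs (t : DTree) (i : List Γ') (o : List O) (a : List Bool) :
    RunsIn (toLeft O) (st i o (t.word ++ a) [] [] []) (st i o (t.left.word ++ a) [] [] [])
      (10 * t.size + 7) := by
  cases t with
  | leaf => exact (RunsIn.ite_false rfl (.skip _)).mono (by omega)
  | node s t =>
    rw [DTree.word, List.cons_append, List.append_assoc]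
    refine (RunsIn.ite_true rfl ((pop_dat ..).seq
      ((moveTree_runs true false s i o (t.word ++ a) [] []).seq
      ((moveTree_runs false false t i o a _ _).seq (flush₁_runs ..))))).of_eq ?_ ?_
    · simp [DTree.left, moved]
    · simp [moved, DTree.length_word]; omega

/-- Push a word. -/
def pushWord (O : Type) : List Bool → Prog (Sym O)
  | [] => .skip
  | s :: w => .seq (pushWord O w) (.push .dat s)

theorem pushWord_runs (w : List Bool) (i : List Γ') (o : List O) (a b c n : List Bool) :
    RunsIn (pushWord O w) (st i o a b c n) (st i o (w ++ a) b c n) (w.length + 1) := by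
  induction w with
  | nil => exact .skip _
  | cons s w ih => exact ih.seq (push_dat ..)

/-- Replace the topmost tree by the tree `t`. -/
def toConst (O : Type) (t : DTree) : Prog (Sym O) :=
  .seq (moveTree O false false) (pushWord O t.word)

theorem toConst_runs (s t : DTree) (i : List Γ') (o : List O) (a : List Bool) :
    RunsIn (toConst O t) (st i o (s.word ++ a) [] [] []) (st i o (t.word ++ a) [] [] [])
      (6 * s.size + t.size + 3) :=
  ((moveTree_runs false false s i o a [] []).seq (pushWord_runs ..)).mono
    (by simp [DTree.size]; omega)

/-- Replace the topmost tree by the truth value telling whether it is a node. -/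
def toIsNode (O : Type) : Prog (Sym O) :=
  .ite .dat (topIs true) (toConst O (.ofBool true)) .skip

theorem toIsNode_runs (t : DTree) (i : List Γ') (o : List O) (a : List Bool) :
    RunsIn (toIsNode O) (st i o (t.word ++ a) [] [] [])
      (st i o ((DTree.ofBool t.isNode).word ++ a) [] [] []) (6 * t.size + 7) := by
  cases t with
  | leaf => exact (RunsIn.ite_false rfl (.skip _)).mono (by omega)
  | node s t =>
    exact (RunsIn.ite_true rfl (toConst_runs (.node s t) _ i o a)).mono (by simp [DTree.ofBool])

/-- Run `p` or `q` on the topmost tree, according to the value of `c` on that tree. -/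
def branch (c p q : Prog (Sym O)) : Prog (Sym O) :=
  .seq (dup O) (.seq c (.ite .dat (topIs true) (.seq (moveTree O false false) p)
    (.seq (moveTree O false false) q)))

/-- Replace the topmost tree `t` by the node formed of the results of `p` and `q` on `t`. -/
def toPair (p q : Prog (Sym O)) : Prog (Sym O) :=
  .seq (dup O) (.seq p (.seq (exchange O) (.seq q (.seq (exchange O) (.push .dat true)))))

/-- Run `p` on the topmost tree as long as the value of `c` on that tree is true. -/
def whileLoop (c p : Prog (Sym O)) : Prog (Sym O) :=
  .seq (dup O) (.seq c (.seq (.loop .dat (topIs true) (.seq (moveTree O false false)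
    (.seq p (.seq (dup O) c)))) (moveTree O false false)))

/-- Pop the two auxiliary stacks in lockstep, and count the differences. -/
def compare (O : Type) : Prog (Sym O) :=
  .loop .aux₁ Option.isSome (.seq
    (.ite .aux₁ (topIs true)
      (.ite .aux₂ (topIs true) .skip (.push .cnt true))
      (.ite .aux₂ (topIs false) .skip (.push .cnt true)))
    (.seq (.pop .aux₁) (.pop .aux₂)))

/-- Empty the second auxiliary stack, and count the symbols. -/
def discard (O : Type) : Prog (Sym O) :=
  .loop .aux₂ Option.isSome (.seq (.pop .aux₂) (.push .cnt true))

/-- Set the counter to zero. -/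
def reset (O : Type) : Prog (Sym O) := .loop .cnt Option.isSome (.pop .cnt)

/-- Replace the topmost two trees by the truth value telling whether they are equal. -/
def toEq (O : Type) : Prog (Sym O) :=
  .seq (moveTree O true false) (.seq (moveTree O false true) (.seq (compare O) (.seq (discard O)
    (.ite .cnt Option.isSome (.seq (reset O) (pushWord O (DTree.ofBool false).word))
      (pushWord O (DTree.ofBool true).word)))))

/-- The counter is zero at the end iff it was zero before and there was nothing to discard. -/
theorem discard_runs (i : List Γ') (o : List O) (a b c n : List Bool) :
    ∃ m, (m = [] ↔ n = [] ∧ c = []) ∧ m.length ≤ n.length + c.length ∧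
      RunsIn (discard O) (st i o a b c n) (st i o a b [] m) (3 * c.length + 1) := by
  induction c generalizing n with
  | nil => exact ⟨n, by simp, by simp, .loop_done rfl⟩
  | cons s c ih =>
    obtain ⟨m, hm, hl, h⟩ := ih (true :: n)
    refine ⟨m, by simp [hm], by simp at *; omega,
      (RunsIn.loop_step (t := 2) rfl ?_ h).mono (by simp; omega)⟩
    exact RunsIn.seq (t := 1) (u := 1) (pop_aux₂ ..) (push_cnt ..)

theorem reset_runs (i : List Γ') (o : List O) (a b c n : List Bool) :
    RunsIn (reset O) (st i o a b c n) (st i o a b c []) (2 * n.length + 1) := by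
  induction n with
  | nil => exact .loop_done rfl
  | cons s n ih =>
    exact (RunsIn.loop_step (t := 1) (c := Option.isSome) rfl (pop_cnt i o a b c n s) ih).mono
      (by simp; omega)

/-- The counter is zero at the end and nothing is left on the second auxiliary stack iff the counter
was zero before and the two stacks were equal. -/
theorem compare_runs (i : List Γ') (o : List O) (a b c n : List Bool) :
    ∃ c' m, (m = [] ∧ c' = [] ↔ n = [] ∧ b = c) ∧ m.length ≤ n.length + b.length ∧
      c'.length ≤ c.length ∧
      RunsIn (compare O) (st i o a b c n) (st i o a [] c' m) (6 * b.length + 1) := by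
  induction b generalizing c n with
  | nil => exact ⟨c, n, by simp [eq_comm], by simp, le_rfl, .loop_done rfl⟩
  | cons s b ih =>
    by_cases hc : c.head? = some s
    · obtain ⟨c, rfl⟩ : ∃ d, c = s :: d := by
        cases c with
        | nil => simp at hc
        | cons x c => exact ⟨c, by simp_all⟩
      obtain ⟨c', m, hm, hl, hl', h⟩ := ih c n
      refine ⟨c', m, by simp [hm], by simp at *; omega, by simp at *; omega,
        (RunsIn.loop_step (t := 5) rfl ?_ h).mono (by simp; omega)⟩
      refine RunsIn.seq (t := 3) (u := 2) ?_ (RunsIn.seq (t := 1) (u := 1)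
        (pop_aux₁ i o a b (s :: c) n s) (pop_aux₂ i o a b (s :: c) n))
      cases s
      · exact .ite_false rfl (.ite_true rfl (.skip _))
      · exact .ite_true rfl (.ite_true rfl (.skip _))
    · obtain ⟨c', m, hm, hl, hl', h⟩ := ih c.tail (true :: n)
      refine ⟨c', m, ?_, by simp at *; omega, hl'.trans (by simp),
        (RunsIn.loop_step (t := 5) rfl ?_ h).mono (by simp; omega)⟩
      · have hbc : s :: b ≠ c := fun h => hc (by rw [← h]; rfl)
        simp [hm, hbc]
      · refine RunsIn.seq (t := 3) (u := 2) (S' := st i o a (s :: b) c (true :: n)) ?_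
          (RunsIn.seq (t := 1) (u := 1) (pop_aux₁ ..) (pop_aux₂ ..))
        cases s
        · refine .ite_false rfl (.ite_false ?_ (push_cnt ..))
          exact beq_eq_false_iff_ne.2 hc
        · refine .ite_true rfl (.ite_false ?_ (push_cnt ..))
          exact beq_eq_false_iff_ne.2 hc

open Classical in
theorem toEq_runs (s t : DTree) (i : List Γ') (o : List O) (a : List Bool) :
    RunsIn (toEq O) (st i o (s.word ++ (t.word ++ a)) [] [] [])
      (st i o ((DTree.ofBool (decide (s = t))).word ++ a) [] [] [])
      (20 * s.size + 20 * t.size + 20) := by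
  obtain ⟨c, n, hn, hl, hl', h⟩ := compare_runs i o a s.word.reverse t.word.reverse []
  obtain ⟨m, hm, hlm, h'⟩ := discard_runs i o a [] c n
  have h₁ := moveTree_runs true false s i o (t.word ++ a) [] []
  have h₂ := moveTree_runs false true t i o a s.word.reverse []
  simp only [moved, cond_true, cond_false, List.append_nil] at h₁ h₂
  simp only [List.length_reverse, List.length_nil, zero_add] at *
  change n.length ≤ s.size at hl
  change c.length ≤ t.size at hl'
  refine (h₁.seq (h₂.seq (h.seq (h'.seq
    (u := 2 * (s.size + t.size) + 8) ?_)))).mono (by simp only [DTree.length_word]; omega)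
  have hst : m = [] ↔ s = t := by
    rw [hm, hn]
    simpa using DTree.word_injective.eq_iff
  by_cases hs : s = t
  · obtain rfl := hst.2 hs
    refine (RunsIn.ite_false rfl (pushWord_runs ..)).of_eq ?_ ?_
    · simp [hs]
    · simp [DTree.ofBool, DTree.word]
  · have hm' : m ≠ [] := fun h => hs (hst.1 h)
    refine (RunsIn.ite_true ?_ ((reset_runs ..).seq (pushWord_runs ..))).of_eq ?_ ?_
    · obtain ⟨x, m, rfl⟩ := List.exists_cons_of_ne_nil hm'
      rfl
    · simp [hs]
    · simp [DTree.ofBool, DTree.word]; omega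

end StackProg

/-! ### Polynomial-time functions on tree-coded data -/

namespace StackProg

open Turing Function Computability Prog Polynomial

/-- Types whose elements are coded by trees. -/
class TreeCode (α : Type) where
  enc : α → DTree
  enc_injective : Injective enc

open TreeCode (enc enc_injective)

/-- The size of the code of `a`. -/
def tsize {α : Type} [TreeCode α] (a : α) : ℕ := (enc a).size

theorem size_enc {α : Type} [TreeCode α] (a : α) : (enc a).size = tsize a := rfl

section instances

variable {α β : Type} [TreeCode α] [TreeCode β]

instance : TreeCode DTree := ⟨id, injective_id⟩

instance : TreeCode Unit := ⟨fun _ => .leaf, fun _ _ _ => rfl⟩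

instance : TreeCode Bool := ⟨.ofBool, by rintro (_ | _) (_ | _) h <;> simp_all [DTree.ofBool]⟩

instance : TreeCode (α × β) :=
  ⟨fun x => .node (enc x.1) (enc x.2), fun x y h => by
    simp only [DTree.node.injEq] at h
    exact Prod.ext (enc_injective h.1) (enc_injective h.2)⟩

/-- The code of a list is a right comb. -/
def encList : List α → DTree
  | [] => .leaf
  | a :: l => .node (enc a) (encList l)

theorem encList_injective : Injective (encList (α := α)) := by
  intro l m h
  induction l generalizing m with
  | nil => cases m <;> simp_all [encList]
  | cons a l ih =>
    cases m with
    | nil => simp [encList] at h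
    | cons b m =>
      simp only [encList, DTree.node.injEq] at h
      rw [enc_injective h.1, ih h.2]

instance : TreeCode (List α) := ⟨encList, encList_injective⟩

/-- Natural numbers are coded in unary. -/
def encUnary : ℕ → DTree
  | 0 => .leaf
  | n + 1 => .node .leaf (encUnary n)

theorem encUnary_injective : Injective encUnary := by
  intro m n h
  induction m generalizing n with
  | zero => cases n <;> simp_all [encUnary]
  | succ m ih =>
    cases n with
    | zero => simp [encUnary] at h
    | succ n =>
      simp only [encUnary, DTree.node.injEq, true_and] at h
      rw [ih h]

instance : TreeCode ℕ := ⟨encUnary, encUnary_injective⟩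

/-- The code of a letter. -/
def encLetter : Γ' → DTree
  | .blank => .leaf
  | .bit b => .node .leaf (.ofBool b)
  | .bra => .node (.ofBool true) .leaf
  | .ket => .node (.ofBool true) (.ofBool true)
  | .comma => .node (.ofBool true) (.node .leaf (.ofBool true))

instance : TreeCode Γ' := ⟨encLetter, by
  intro s t h
  cases s <;> cases t <;> simp_all [encLetter, DTree.ofBool]
  next b c => cases b <;> cases c <;> simp_all⟩

@[simp] theorem tsize_prod (x : α × β) : tsize x = tsize x.1 + tsize x.2 + 1 :=
  DTree.size_node _ _

@[simp] theorem tsize_nil : tsize ([] : List α) = 1 := rfl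

@[simp] theorem tsize_cons (a : α) (l : List α) : tsize (a :: l) = tsize a + tsize l + 1 :=
  DTree.size_node _ _

@[simp] theorem tsize_succ (n : ℕ) : tsize (n + 1) = tsize n + 2 := by
  refine (DTree.size_node _ _).trans ?_
  rw [DTree.size_leaf, tsize]
  exact Nat.add_assoc 1 _ 1 |>.trans (Nat.add_comm _ _) |>.trans (by rfl)

theorem tsize_nat (n : ℕ) : tsize n = 2 * n + 1 := by
  induction n with
  | zero => rfl
  | succ n ih => rw [tsize_succ, ih]; ring

theorem tsize_bool (b : Bool) : tsize b ≤ 3 := by cases b <;> decide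

theorem tsize_append (l m : List α) : tsize (l ++ m) + 1 = tsize l + tsize m := by
  induction l with
  | nil => simp; omega
  | cons a l ih => simp; omega

theorem tsize_reverse (l : List α) : tsize l.reverse = tsize l := by
  induction l with
  | nil => rfl
  | cons a l ih =>
    have := tsize_append l.reverse [a]
    simp at *; omega

theorem length_lt_tsize (l : List α) : l.length < tsize l := by
  induction l with
  | nil => simp
  | cons a l ih => simp; omega

theorem tsize_le_of_sublist {l m : List α} (h : List.Sublist l m) : tsize l ≤ tsize m := by
  induction h with
  | slnil => exact le_rfl
  | cons a _ ih => simp; omega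
  | cons_cons a _ ih => simp; omega

theorem tsize_le_of_mem {a : α} {l : List α} (h : a ∈ l) : tsize a ≤ tsize l := by
  induction l with
  | nil => simp at h
  | cons b l ih =>
    rcases List.mem_cons.1 h with rfl | h
    · simp; omega
    · have := ih h
      simp; omega

end instances

theorem eval_le_eval (P : ℕ[X]) {m n : ℕ} (h : m ≤ n) : P.eval m ≤ P.eval n := by
  rw [eval_eq_sum, eval_eq_sum]
  exact Finset.sum_le_sum fun i _ => Nat.mul_le_mul_left _ (Nat.pow_le_pow_left h i)

variable {α β γ δ σ : Type} [TreeCode α] [TreeCode β] [TreeCode γ] [TreeCode δ] [TreeCode σ]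

/-- Polynomial-time functions: a stack program replaces the code of `x` on top of the main stack by
the code of `f x`, in a time (and with a result size) polynomial in the size of `x`. The programs
exist for every output alphabet `O`, because they do not touch the output stack. -/
@[fun_prop]
def PT (f : α → β) : Prop :=
  ∀ O : Type, ∃ (p : Prog (Sym O)) (P : ℕ[X]), ∀ x : α, tsize (f x) ≤ P.eval (tsize x) ∧
    ∀ i o a, RunsIn p (st i o ((enc x).word ++ a) [] [] [])
      (st i o ((enc (f x)).word ++ a) [] [] []) (P.eval (tsize x))

namespace PT

theorem tsize_le {f : α → β} (hf : PT f) : ∃ P : ℕ[X], ∀ x, tsize (f x) ≤ P.eval (tsize x) := by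
  obtain ⟨_, P, h⟩ := hf Unit
  exact ⟨P, fun x => (h x).1⟩

/-- Changing the type of the result without changing its code. -/
theorem of_enc {f : α → β} {g : α → γ} (hg : PT g) (h : ∀ x, enc (f x) = enc (g x)) : PT f := by
  intro O
  obtain ⟨p, P, hp⟩ := hg O
  refine ⟨p, P, fun x => ?_⟩
  rw [tsize, h]
  exact hp x

@[fun_prop]
theorem id : PT fun x : α => x := fun O =>
  ⟨.skip, X + 1, fun x => ⟨by simp, fun i o a => (RunsIn.skip _).mono (by simp)⟩⟩

@[fun_prop]
theorem const (b : β) : PT fun _ : α => b := fun O =>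
  ⟨toConst O (enc b), 6 * X + C (tsize b + 3), fun x =>
    ⟨by simp; omega, fun i o a =>
      (toConst_runs (enc x) (enc b) i o a).mono (by simp [tsize, add_assoc])⟩⟩

@[fun_prop]
theorem comp {g : β → γ} {f : α → β} (hg : PT g) (hf : PT f) : PT fun x => g (f x) := by
  intro O
  obtain ⟨p, P, hp⟩ := hf O
  obtain ⟨q, Q, hq⟩ := hg O
  refine ⟨.seq p q, P + Q.comp P, fun x => ?_⟩
  have h := eval_le_eval Q (hp x).1
  simp only [eval_add, eval_comp]
  exact ⟨(hq (f x)).1.trans (by omega), fun i o a =>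
    (((hp x).2 i o a).seq ((hq (f x)).2 i o a)).mono (by omega)⟩

@[fun_prop]
theorem pair {f : α → β} {g : α → γ} (hf : PT f) (hg : PT g) : PT fun x => (f x, g x) := by
  intro O
  obtain ⟨p, P, hp⟩ := hf O
  obtain ⟨q, Q, hq⟩ := hg O
  refine ⟨toPair p q, 21 * P + 11 * Q + 24 * X + 30, fun x => ?_⟩
  have h₁ := (hp x).1
  have h₂ := (hq x).1
  simp only [eval_add, eval_mul, eval_ofNat, eval_X, tsize_prod]
  refine ⟨by omega, fun i o a => ?_⟩
  have h := (dup_runs (enc x) i o a).seq (((hp x).2 i o _).seq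
    ((exchange_runs (enc (f x)) (enc x) i o a).seq (((hq x).2 i o _).seq
    ((exchange_runs (enc (g x)) (enc (f x)) i o a).seq (push_dat _ _ _ _ _ _ true)))))
  refine h.of_eq ?_ ?_
  · simp [enc, DTree.word]
  · simp only [size_enc]
    omega

@[fun_prop]
theorem fst : PT fun x : α × β => x.1 := fun O =>
  ⟨toLeft O, 10 * X + 7, fun x => ⟨by simp; omega, fun i o a =>
    (toLeft_runs (enc x) i o a).of_eq rfl (by simp [size_enc])⟩⟩

@[fun_prop]
theorem snd : PT fun x : α × β => x.2 := fun O =>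
  ⟨toRight O, 6 * X + 4, fun x => ⟨by simp; omega, fun i o a =>
    (toRight_runs (enc x) i o a).of_eq rfl (by simp [tsize, enc])⟩⟩

theorem left : PT DTree.left := fun O =>
  ⟨toLeft O, 10 * X + 7, fun x => ⟨by cases x <;> simp [DTree.left, tsize, enc]; omega, fun i o a =>
    (toLeft_runs x i o a).of_eq rfl (by simp [tsize, enc])⟩⟩

theorem right : PT DTree.right := fun O =>
  ⟨toRight O, 6 * X + 4, fun x => ⟨by cases x <;> simp [DTree.right, tsize, enc]; omega,
    fun i o a => (toRight_runs x i o a).of_eq rfl (by simp [tsize, enc])⟩⟩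

theorem isNode : PT DTree.isNode := fun O =>
  ⟨toIsNode O, 6 * X + 7, fun x => ⟨(tsize_bool _).trans (by simp), fun i o a =>
    (toIsNode_runs x i o a).of_eq rfl (by simp [tsize, enc])⟩⟩

theorem toTree {f : α → β} (hf : PT f) : PT fun x => enc (f x) := hf.of_enc fun _ => rfl

@[fun_prop]
theorem decide_eq [DecidableEq β] {f g : α → β} (hf : PT f) (hg : PT g) :
    PT fun x => decide (f x = g x) := by
  have h : PT fun z : β × β => decide (z.1 = z.2) := by
    intro O
    -- only the pair node has to be removed before comparing
    refine ⟨.seq (.pop .dat) (toEq O), 20 * X + 21,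
      fun x => ⟨(tsize_bool _).trans (by simp), fun i o a => ?_⟩⟩
    have h := (pop_dat i o ((enc x.1).word ++ (enc x.2).word ++ a) [] [] [] true).seq
      (List.append_assoc _ _ a ▸ toEq_runs (enc x.1) (enc x.2) i o a)
    refine h.of_eq ?_ ?_
    · congr 4
      exact decide_eq_decide.2 (enc_injective (α := β)).eq_iff
    · simp only [eval_add, eval_mul, eval_ofNat, eval_X, tsize_prod, size_enc]
      omega
  exact h.comp (hf.pair hg)

@[fun_prop]
theorem cond {c : α → Bool} {f g : α → β} (hc : PT c) (hf : PT f) (hg : PT g) :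
    PT fun x => bif c x then f x else g x := by
  intro O
  obtain ⟨r, R, hr⟩ := hc O
  obtain ⟨p, P, hp⟩ := hf O
  obtain ⟨q, Q, hq⟩ := hg O
  refine ⟨branch r p q, R + P + Q + 14 * X + 30, fun x => ?_⟩
  have h₁ := (hp x).1
  have h₂ := (hq x).1
  simp only [eval_add, eval_mul, eval_ofNat, eval_X]
  refine ⟨by cases c x <;> simp <;> omega, fun i o a => ?_⟩
  refine ((dup_runs (enc x) i o a).seq (((hr x).2 i o _).seq
    (u := P.eval (tsize x) + Q.eval (tsize x) + 21) ?_)).mono (by simp only [size_enc]; omega)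
  cases hx : c x
  · exact (RunsIn.ite_false rfl ((moveTree_runs false false (.ofBool false) i o _ [] []).seq
      ((hq x).2 i o a))).of_eq rfl (by simp [DTree.ofBool]; omega)
  · exact (RunsIn.ite_true rfl ((moveTree_runs false false (.ofBool true) i o _ [] []).seq
      ((hp x).2 i o a))).of_eq rfl (by simp [DTree.ofBool]; omega)

theorem loop_runs {O : Type} {c : α → Bool} {f : α → α}
    {p r : Prog (Sym O)} {P R : ℕ[X]}
    (hr : ∀ x : α, ∀ i o a, RunsIn r (st i o ((enc x).word ++ a) [] [] [])
      (st i o ((enc (c x)).word ++ a) [] [] []) (R.eval (tsize x)))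
    (hp : ∀ x : α, ∀ i o a, RunsIn p (st i o ((enc x).word ++ a) [] [] [])
      (st i o ((enc (f x)).word ++ a) [] [] []) (P.eval (tsize x))) (M k : ℕ) (x : α)
    (hc : ∀ i < k, c (f^[i] x) = true) (hk : c (f^[k] x) = false)
    (hM : ∀ i ≤ k, tsize (f^[i] x) ≤ M) (i o a) :
    RunsIn (.loop .dat (topIs true) (.seq (moveTree O false false) (.seq p (.seq (dup O) r))))
      (st i o ((enc (c x)).word ++ ((enc x).word ++ a)) [] [] [])
      (st i o ((enc false).word ++ ((enc (f^[k] x)).word ++ a)) [] [] [])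
      (k * (P.eval M + R.eval M + 14 * M + 30) + 1) := by
  induction k generalizing x with
  | zero =>
    rw [iterate_zero, id_eq] at hk
    rw [hk]
    exact (RunsIn.loop_done rfl).mono (by omega)
  | succ k ih =>
    have h₀ : c x = true := hc 0 (by omega)
    have hx : tsize x ≤ M := hM 0 (by omega)
    have hfx : tsize (f x) ≤ M := hM 1 (by omega)
    have h := ih (f x) (fun i hi => hc (i + 1) (by omega)) hk fun i hi => hM (i + 1) (by omega)
    rw [h₀]
    refine (RunsIn.loop_step rfl ((moveTree_runs false false (.ofBool true) i o _ [] []).seq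
      ((hp x i o a).seq ((dup_runs (enc (f x)) i o a).seq (hr (f x) i o _)))) h).of_eq rfl ?_
    have h₁ := eval_le_eval P hx
    have h₂ := eval_le_eval R hfx
    rw [add_mul]
    simp only [size_enc, DTree.ofBool, DTree.size_node, DTree.size_leaf]
    omega

/-- Iterating a polynomial-time function as long as a condition holds, under polynomial bounds for
the number of rounds and for the sizes of all intermediate values. -/
theorem whileLoop {start : γ → α} {c : α → Bool} {f : α → α} (hs : PT start) (hc : PT c) (hf : PT f)
    (k : γ → ℕ) (Q : ℕ[X]) (hct : ∀ z, ∀ i < k z, c (f^[i] (start z)) = true)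
    (hcf : ∀ z, c (f^[k z] (start z)) = false) (hk : ∀ z, k z ≤ Q.eval (tsize z))
    (hM : ∀ z, ∀ i ≤ k z, tsize (f^[i] (start z)) ≤ Q.eval (tsize z)) :
    PT fun z => f^[k z] (start z) := by
  intro O
  obtain ⟨s, S, hs⟩ := hs O
  obtain ⟨r, R, hr⟩ := hc O
  obtain ⟨p, P, hp⟩ := hf O
  refine ⟨.seq s (StackProg.whileLoop r p),
    S + 14 * Q + R.comp Q + Q * (P.comp Q + R.comp Q + 14 * Q + 30) + 20, fun z => ?_⟩
  simp only [eval_add, eval_mul, eval_ofNat, eval_comp]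
  set M := Q.eval (tsize z)
  refine ⟨(hM z _ le_rfl).trans (by omega), fun i o a => ?_⟩
  have h₀ : tsize (start z) ≤ M := hM z 0 (by omega)
  have h₁ := eval_le_eval R h₀
  refine (((hs z).2 i o a).seq ((dup_runs (enc (start z)) i o a).seq (((hr _).2 i o _).seq
    ((loop_runs (fun x => (hr x).2) (fun x => (hp x).2) M (k z) (start z) (hct z) (hcf z) (hM z)
      i o a).seq (moveTree_runs false false (.ofBool false) i o _ [] []))))).of_eq rfl ?_
  have h₂ : k z * _ ≤ M * _ := Nat.mul_le_mul_right (P.eval M + R.eval M + 14 * M + 30) (hk z)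
  simp only [size_enc, DTree.ofBool, DTree.size_leaf]
  omega

end PT

end StackProg

/-! ### Polynomial-time list functions -/

namespace StackProg

open TreeCode (enc enc_injective)
open Polynomial

variable {α β γ δ σ : Type} [TreeCode α] [TreeCode β] [TreeCode γ] [TreeCode δ] [TreeCode σ]

namespace PT

theorem comp₂ {f : β → γ → δ} (hf : PT fun z : β × γ => f z.1 z.2) {g : α → β} {h : α → γ}
    (hg : PT g) (hh : PT h) : PT fun x => f (g x) (h x) :=
  hf.comp (hg.pair hh)

@[fun_prop]
theorem not {p : α → Bool} (hp : PT p) : PT fun x => !p x :=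
  (hp.cond (const false) (const true)).of_enc fun x => by cases p x <;> rfl

@[fun_prop]
theorem and {p q : α → Bool} (hp : PT p) (hq : PT q) : PT fun x => p x && q x :=
  (hp.cond hq (const false)).of_enc fun x => by cases p x <;> rfl

@[fun_prop]
theorem or {p q : α → Bool} (hp : PT p) (hq : PT q) : PT fun x => p x || q x :=
  (hp.cond (const true) hq).of_enc fun x => by cases p x <;> rfl

@[fun_prop]
theorem xor {p q : α → Bool} (hp : PT p) (hq : PT q) : PT fun x => Bool.xor (p x) (q x) :=
  (hp.cond hq.not hq).of_enc fun x => by cases p x <;> cases q x <;> rfl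

@[fun_prop]
theorem succ {f : α → ℕ} (hf : PT f) : PT fun x => f x + 1 :=
  ((const ()).pair hf).of_enc fun _ => rfl

@[fun_prop]
theorem cons {f : α → β} {l : α → List β} (hf : PT f) (hl : PT l) : PT fun x => f x :: l x :=
  (hf.pair hl).of_enc fun _ => rfl

@[fun_prop]
theorem isEmpty {l : α → List β} (hl : PT l) : PT fun x => (l x).isEmpty :=
  (isNode.comp hl.toTree).not.of_enc fun x => by cases l x <;> rfl

@[fun_prop]
theorem tail {l : α → List β} (hl : PT l) : PT fun x => (l x).tail :=
  (right.comp hl.toTree).of_enc fun x => by cases l x <;> rfl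

@[fun_prop]
theorem headD {l : α → List β} {d : α → β} (hl : PT l) (hd : PT d) :
    PT fun x => (l x).headD (d x) :=
  (hl.isEmpty.cond hd.toTree (left.comp hl.toTree)).of_enc fun x => by cases l x <;> rfl

theorem foldl_loop {α γ σ : Type} (step : γ → σ → α → σ) (d : α) (i : ℕ) (c : γ) (l : List α)
    (s : σ) (hi : i ≤ l.length) :
    (fun z : γ × List α × σ => (z.1, z.2.1.tail, step z.1 z.2.2 (z.2.1.headD d)))^[i] (c, l, s) =
      (c, l.drop i, (l.take i).foldl (step c) s) := by
  induction i generalizing l s with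
  | zero => simp
  | succ i ih =>
    rw [Function.iterate_succ_apply]
    cases l with
    | nil => simp at hi
    | cons a l => exact ih l (step c s a) (by simpa using hi)

/-- Folding a polynomial-time function over a list, under a polynomial bound for the sizes of all
intermediate values. -/
theorem foldl {l : γ → List α} {init : γ → σ} {step : γ → σ → α → σ} (hl : PT l) (hi : PT init)
    (hs : PT fun z : γ × σ × α => step z.1 z.2.1 z.2.2) (Q : ℕ[X])
    (hQ : ∀ c, ∀ m, m <+: l c → tsize (m.foldl (step c) (init c)) ≤ Q.eval (tsize c)) :
    PT fun c => (l c).foldl (step c) (init c) := by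
  rcases isEmpty_or_nonempty α with hα | ⟨⟨d⟩⟩
  · exact hi.of_enc fun c => by rw [Subsingleton.elim (l c) []]; rfl
  obtain ⟨P, hP⟩ := hl.tsize_le
  have hf : PT fun z : γ × List α × σ => (z.1, z.2.1.tail, step z.1 z.2.2 (z.2.1.headD d)) :=
    fst.pair (PT.pair (by fun_prop) (hs.comp (g := fun z => step z.1 z.2.1 z.2.2)
      (f := fun z : γ × List α × σ => (z.1, z.2.2, z.2.1.headD d)) (by fun_prop)))
  have hw := whileLoop (γ := γ) (start := fun c => (c, l c, init c))
    (c := fun z => !z.2.1.isEmpty) (by fun_prop) (by fun_prop) hf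
    (fun c => (l c).length) (X + P + Q + 2) ?_ ?_ ?_ ?_
  · have h : PT fun z : γ × List α × σ => z.2.2 := by fun_prop
    exact (h.comp hw).of_enc fun c => by rw [foldl_loop _ _ _ _ _ _ le_rfl, List.take_length]
  · intro c i hi
    rw [foldl_loop _ _ _ _ _ _ hi.le]
    simpa using hi
  · intro c
    rw [foldl_loop _ _ _ _ _ _ le_rfl]
    simp
  · intro c
    have := length_lt_tsize (l c)
    have := hP c
    simp only [eval_add, eval_X, eval_ofNat]
    omega
  · intro c i hi
    rw [foldl_loop _ _ _ _ _ _ hi]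
    have h₁ := hP c
    have h₂ := hQ c _ (List.take_prefix i (l c))
    have h₃ := tsize_le_of_sublist (List.drop_sublist i (l c))
    simp only [eval_add, eval_X, eval_ofNat, tsize_prod]
    omega

/-- Folding a polynomial-time function over a list, if each step adds at most a polynomial to the
size. -/
theorem foldl_of_add {l : γ → List α} {init : γ → σ} {step : γ → σ → α → σ} (hl : PT l)
    (hi : PT init) (hs : PT fun z : γ × σ × α => step z.1 z.2.1 z.2.2) (B : ℕ[X])
    (hB : ∀ c, ∀ a ∈ l c, ∀ s, tsize (step c s a) ≤ tsize s + B.eval (tsize c)) :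
    PT fun c => (l c).foldl (step c) (init c) := by
  obtain ⟨P, hP⟩ := hl.tsize_le
  obtain ⟨I, hI⟩ := hi.tsize_le
  refine foldl hl hi hs (I + P * B) fun c m hm => ?_
  have h : ∀ (m : List α) (s : σ), m ⊆ l c →
      tsize (m.foldl (step c) s) ≤ tsize s + m.length * B.eval (tsize c) := by
    intro m
    induction m with
    | nil => simp
    | cons a m ih =>
      intro s hm
      have h₁ := ih (step c s a) fun x hx => hm (List.mem_cons_of_mem _ hx)
      have h₂ := hB c a (hm List.mem_cons_self) s
      rw [List.foldl_cons, List.length_cons, add_mul]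
      omega
  have h₁ := h m (init c) hm.subset
  have h₂ : m.length ≤ P.eval (tsize c) :=
    hm.length_le.trans ((length_lt_tsize _).le.trans (hP c))
  have h₃ := Nat.mul_le_mul_right (B.eval (tsize c)) h₂
  have h₄ := hI c
  simp only [eval_add, eval_mul]
  omega

theorem foldl_bool {l : γ → List α} {init : γ → Bool} {step : γ → Bool → α → Bool} (hl : PT l)
    (hi : PT init) (hs : PT fun z : γ × Bool × α => step z.1 z.2.1 z.2.2) :
    PT fun c => (l c).foldl (step c) (init c) :=
  foldl hl hi hs 3 fun c m _ => (tsize_bool _).trans (by simp)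

@[fun_prop]
theorem any {l : γ → List α} {p : γ → α → Bool} (hl : PT l) (hp : PT fun z : γ × α => p z.1 z.2) :
    PT fun c => (l c).any (p c) := by
  have hs : PT fun z : γ × Bool × α => z.2.1 || p z.1 z.2.2 :=
    or (by fun_prop) (comp₂ hp (by fun_prop) (by fun_prop))
  refine (foldl_bool (step := fun c b a => b || p c a) hl (const false) hs).of_enc fun c => ?_
  have h : ∀ (m : List α) (b : Bool), m.foldl (fun b a => b || p c a) b = (b || m.any (p c)) := by
    intro m
    induction m with
    | nil => simp
    | cons a m ih => intro b; simp [ih, Bool.or_assoc]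
  rw [h, Bool.false_or]

@[fun_prop]
theorem all {l : γ → List α} {p : γ → α → Bool} (hl : PT l) (hp : PT fun z : γ × α => p z.1 z.2) :
    PT fun c => (l c).all (p c) :=
  (any (p := fun c a => !p c a) hl hp.not).not.of_enc fun c => by simp [List.all_eq_not_any_not]

@[fun_prop]
theorem decide_mem {f : α → β} {l : α → List β} [∀ x, Decidable (f x ∈ l x)] (hf : PT f)
    (hl : PT l) : PT fun x => decide (f x ∈ l x) := by
  classical
  refine (any (p := fun x b => decide (f x = b)) hl
    (decide_eq (hf.comp fst) snd)).of_enc fun x => ?_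
  congr 1
  rw [Bool.eq_iff_iff]
  simp

theorem reverseAux {l m : γ → List α} (hl : PT l) (hm : PT m) :
    PT fun c => (l c).reverse ++ m c := by
  obtain ⟨P, hP⟩ := hl.tsize_le
  refine (foldl_of_add (step := fun _ s a => a :: s) hl hm (by fun_prop) (P + 1)
    fun c a ha s => ?_).of_enc fun c => ?_
  · have := (tsize_le_of_mem ha).trans (hP c)
    simp
    omega
  · congr 1
    induction l c generalizing m with
    | nil => rfl
    | cons a l ih => simp [List.foldl_cons]

@[fun_prop]
theorem reverse {l : γ → List α} (hl : PT l) : PT fun c => (l c).reverse :=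
  (reverseAux hl (const [])).of_enc fun c => by simp

@[fun_prop]
theorem append {l m : γ → List α} (hl : PT l) (hm : PT m) : PT fun c => l c ++ m c :=
  (reverseAux hl.reverse hm).of_enc fun c => by simp

@[fun_prop]
theorem flatMap {l : γ → List α} {f : γ → α → List β} (hl : PT l)
    (hf : PT fun z : γ × α => f z.1 z.2) : PT fun c => (l c).flatMap (f c) := by
  obtain ⟨P, hP⟩ := hl.tsize_le
  obtain ⟨F, hF⟩ := hf.tsize_le
  have hs : PT fun z : γ × List β × α => (f z.1 z.2.2).reverse ++ z.2.1 :=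
    reverseAux (comp₂ hf (by fun_prop) (by fun_prop)) (by fun_prop)
  refine (foldl_of_add (step := fun c s a => (f c a).reverse ++ s) hl (const []) hs
    (F.comp (X + P + 1)) fun c a ha s => ?_).reverse.of_enc fun c => ?_
  · have h₁ := (tsize_le_of_mem ha).trans (hP c)
    have h₂ : tsize (f c a) ≤ F.eval (tsize (c, a)) := hF (c, a)
    have h₃ := eval_le_eval F (m := tsize (c, a)) (n := tsize c + P.eval (tsize c) + 1)
      (by simp; omega)
    have h₄ := tsize_append (f c a).reverse s
    rw [tsize_reverse] at h₄
    simp only [eval_comp, eval_add, eval_X, eval_one]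
    omega
  · congr 1
    have h : ∀ (m : List α) (s : List β), (m.foldl (fun s a => (f c a).reverse ++ s) s).reverse =
        s.reverse ++ m.flatMap (f c) := by
      intro m
      induction m with
      | nil => simp
      | cons a m ih => intro s; rw [List.foldl_cons, ih]; simp
    rw [h]
    rfl

@[fun_prop]
theorem map {l : γ → List α} {f : γ → α → β} (hl : PT l) (hf : PT fun z : γ × α => f z.1 z.2) :
    PT fun c => (l c).map (f c) :=
  (flatMap (f := fun c a => [f c a]) hl (hf.cons (const []))).of_enc fun c => by
    rw [List.map_eq_flatMap]

@[fun_prop]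
theorem filter {l : γ → List α} {p : γ → α → Bool} (hl : PT l)
    (hp : PT fun z : γ × α => p z.1 z.2) : PT fun c => (l c).filter (p c) :=
  (flatMap (f := fun c a => bif p c a then [a] else []) hl
    (hp.cond (snd.cons (const [])) (const []))).of_enc fun c => by
      congr 1
      induction l c with
      | nil => rfl
      | cons a l ih => cases h : p c a <;> simp [h, ih]

theorem units {f : γ → ℕ} (hf : PT f) : PT fun c => List.replicate (f c) () :=
  hf.of_enc fun c => by
    induction f c with
    | zero => rfl
    | succ n ih => exact congrArg (DTree.node .leaf) ih

@[fun_prop]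
theorem length {l : γ → List α} (hl : PT l) : PT fun c => (l c).length :=
  (foldl_of_add (step := fun _ n _ => n + 1) hl (const 0) (by fun_prop) 2
    fun c a _ s => by simp).of_enc fun c => by
      congr 1
      have h : ∀ (m : List α) (n : ℕ), m.foldl (fun n _ => n + 1) n = n + m.length := by
        intro m
        induction m with
        | nil => simp
        | cons a m ih => intro n; simp [ih]; omega
      rw [h, zero_add]

@[fun_prop]
theorem drop {f : γ → ℕ} {l : γ → List α} (hf : PT f) (hl : PT l) :
    PT fun c => (l c).drop (f c) :=
  (foldl_of_add (step := fun _ s _ => s.tail) hf.units hl (by fun_prop) 0 fun c a _ s => by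
    simpa using tsize_le_of_sublist (List.tail_sublist s)).of_enc fun c => by
      congr 1
      generalize l c = m
      induction f c generalizing m with
      | zero => rfl
      | succ n ih => rw [List.replicate_succ, List.foldl_cons, ← ih, List.drop_tail]

@[fun_prop]
theorem getD {l : γ → List α} {f : γ → ℕ} {d : γ → α} (hl : PT l) (hf : PT f) (hd : PT d) :
    PT fun c => (l c).getD (f c) (d c) :=
  (headD (hf.drop hl) hd).of_enc fun c => by
    rw [List.headD_eq_head?_getD, List.head?_drop, List.getD_eq_getElem?_getD]

@[fun_prop]
theorem range {f : γ → ℕ} (hf : PT f) : PT fun c => List.range (f c) := by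
  obtain ⟨P, hP⟩ := hf.tsize_le
  have h : ∀ n : ℕ, (List.replicate n ()).foldl (fun s _ => s.length :: s) [] =
      (List.range n).reverse := by
    intro n
    induction n with
    | zero => rfl
    | succ n ih => rw [List.replicate_succ', List.foldl_append, ih, List.range_succ]; simp
  have h' : ∀ n : ℕ, tsize (List.range n) ≤ 1 + n * (2 * n) := by
    intro n
    induction n with
    | zero => simp
    | succ n ih =>
      have := tsize_append (List.range n) [n]
      simp only [List.range_succ, tsize_cons, tsize_nil, tsize_nat] at *
      nlinarith
  refine (foldl (step := fun _ (s : List ℕ) _ => s.length :: s) hf.units (const []) (by fun_prop)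
    (1 + P * (2 * P)) fun c m hm => ?_).reverse.of_enc fun c => by rw [h, List.reverse_reverse]
  obtain ⟨k, rfl⟩ : ∃ k, m = List.replicate k () := ⟨m.length, by simp [List.eq_replicate_iff]⟩
  have h₁ := hm.length_le
  rw [List.length_replicate, List.length_replicate] at h₁
  have h₂ := hP c
  rw [tsize_nat] at h₂
  rw [h, tsize_reverse]
  refine (h' _).trans ?_
  simp only [eval_add, eval_mul, eval_one, eval_ofNat]
  gcongr <;> omega

end PT

end StackProg

/-! ### From polynomial-time functions to polynomial-time machines -/

namespace StackProg

open TreeCode (enc enc_injective)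
open Turing Function Computability Prog Polynomial

variable {O : Type}

/-- Remove the top letter of the input, if it is one of the letters in the list, and run the program
for this letter. -/
def switch (p : Γ' → Prog (Sym O)) : List Γ' → Prog (Sym O)
  | [] => .skip
  | s :: l => .ite .inp (fun o : Option Γ' => o == some s) (.seq (.pop .inp) (p s)) (switch p l)

theorem switch_runs {p : Γ' → Prog (Sym O)} {s : Γ'} {w : List Γ'} {o : List O}
    {a b c n : List Bool} {S : ∀ k, List (Sym O k)} {t : ℕ} {l : List Γ'} (hs : s ∈ l)
    (h : RunsIn (p s) (st w o a b c n) S t) :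
    RunsIn (switch p l) (st (s :: w) o a b c n) S (t + 1 + l.length) := by
  induction l with
  | nil => simp at hs
  | cons s' l ih =>
    by_cases hss : s = s'
    · subst hss
      exact (RunsIn.ite_true (beq_self_eq_true (some s)) ((RunsIn.pop _ (st_inp ..)).seq h)).mono
        (by simp; omega)
    · have hc : (some s == some s') = false := by simpa using hss
      exact (RunsIn.ite_false (S := st (s :: w) o a b c n) hc
        (ih ((List.mem_cons.1 hs).resolve_left hss))).mono (by simp)

/-- All letters. -/
def letters : List Γ' := [.blank, .bit false, .bit true, .bra, .ket, .comma]

theorem mem_letters (s : Γ') : s ∈ letters := by rcases s with _ | (_ | _) | _ | _ | _ <;> decide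

/-- Move the input to the main stack, as the code of a list. The first letter of the input ends up
at the end of this list. -/
def loadInput (O : Type) : Prog (Sym O) :=
  .seq (.push .dat false) (.loop .inp Option.isSome
    (switch (fun s => pushWord O (true :: (enc s).word)) letters))

theorem tsize_letter (s : Γ') : tsize s ≤ 9 := by
  rcases s with _ | (_ | _) | _ | _ | _ <;> decide

theorem tsize_word (w : List Γ') : tsize w ≤ 10 * w.length + 1 := by
  induction w with
  | nil => simp
  | cons s w ih =>
    have := tsize_letter s
    simp
    omega

theorem loadInput_runs (w : List Γ') (o : List O) :
    RunsIn (loadInput O) (st w o [] [] [] []) (st [] o (enc w.reverse).word [] [] [])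
      (20 * w.length + 2) := by
  have h : ∀ l : List Γ', RunsIn (.loop .inp Option.isSome
      (switch (fun s => pushWord O (true :: (enc s).word)) letters))
      (st w o (enc l).word [] [] []) (st [] o (enc (w.reverse ++ l)).word [] [] [])
      (20 * w.length + 1) := by
    induction w with
    | nil => exact fun l => .loop_done rfl
    | cons s w ih =>
      intro l
      have h₁ := switch_runs (O := O) (mem_letters s)
        (p := fun s => pushWord O (true :: (enc s).word))
        (pushWord_runs (true :: (enc s).word) w o (enc l).word [] [] [])
      refine (RunsIn.loop_step rfl h₁ (ih (s :: l))).of_eq (by simp) ?_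
      · have := tsize_letter s
        simp [letters, DTree.length_word, size_enc]
        omega
  exact ((push_dat ..).seq (h [])).of_eq (by simp) (by omega)

/-- Remove the unary number `k` from the main stack, and output the letter number `k` of the
list. -/
def emit : List O → Prog (Sym O)
  | [] => .skip
  | x :: l => .ite .dat (topIs true) (.seq (.pop .dat) (.seq (.pop .dat) (emit l)))
      (.seq (.pop .dat) (.push .out x))

theorem emit_runs {l : List O} {k : ℕ} {x : O} (h : l[k]? = some x) (i : List Γ') (o : List O)
    (a b c n : List Bool) :
    RunsIn (emit l) (st i o ((enc k).word ++ a) b c n) (st i (x :: o) a b c n) (3 * k + 3) := by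
  induction l generalizing k with
  | nil => simp at h
  | cons y l ih =>
    cases k with
    | zero =>
      obtain rfl : y = x := by simpa using h
      exact .ite_false rfl ((pop_dat ..).seq (.push _ _ (st_out ..)))
    | succ k =>
      exact (RunsIn.ite_true rfl ((pop_dat ..).seq ((pop_dat ..).seq
        (ih (k := k) (by simpa using h))))).mono (by omega)

/-- Output a list of unary numbers from the main stack, starting at the head of the list. -/
def emitAll (l : List O) : Prog (Sym O) :=
  .seq (.loop .dat (topIs true) (.seq (.pop .dat) (emit l))) (.pop .dat)

theorem emitAll_runs {l : List O} {ks : List ℕ} {xs : List O}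
    (h : ks.map (fun k => l[k]?) = xs.map some) (i : List Γ') (o : List O) :
    RunsIn (emitAll l) (st i o (enc ks).word [] [] []) (st i (xs.reverse ++ o) [] [] [] [])
      (5 * tsize ks + 2) := by
  refine RunsIn.seq (t := 5 * tsize ks + 1) (u := 1) (S' := st i (xs.reverse ++ o) [false] [] [] [])
    ?_ (pop_dat ..)
  induction ks generalizing xs o with
  | nil =>
    obtain rfl : xs = [] := by simpa using h
    exact (RunsIn.loop_done rfl).mono (by omega)
  | cons k ks ih =>
    cases xs with
    | nil => simp at h
    | cons x xs =>
      simp only [List.map_cons, List.cons.injEq] at h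
      have h₁ := emit_runs h.1 i o (enc ks).word [] [] []
      refine (RunsIn.loop_step rfl ((pop_dat ..).seq h₁) (ih h.2 (x :: o))).of_eq (by simp) ?_
      have := tsize_nat k
      rw [tsize_cons]
      omega

/-- A function is computable in polynomial time by a multi-stack machine if it is given by a
polynomial-time function on the codes of words. The letters of the output word are specified by
their positions in the list `os`. Both words are reversed, since their first letters are on the
tops of the stacks. Any polynomial may be added to the time bound. -/
theorem PT.exists_machine {ι β : Type} {ea : ι → List Γ'} {eb : β → List O} {g : ι → β}
    {f : List Γ' → List ℕ} (hf : PT f) (os : List O)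
    (h : ∀ a, (f (ea a).reverse).map (fun k => os[k]?) = ((eb (g a)).reverse).map some) :
    ∃ P : ℕ[X], ∀ Q : ℕ[X], ∃ A : TM2ComputableInPolyTime ea eb g, A.time = P + Q := by
  obtain ⟨p, P, hp⟩ := hf O
  let q : Prog (Sym O) := .seq (loadInput O) (.seq p (emitAll os))
  let T : ℕ[X] := 20 * X + 6 * P.comp (10 * X + 1) + 5
  have key : ∀ a, RunsIn q (st (ea a) [] [] [] [] []) (st [] (eb (g a)) [] [] [] [])
      (20 * (ea a).length + 6 * P.eval (10 * (ea a).length + 1) + 4) := by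
    intro a
    have h₁ := hp (ea a).reverse
    have h₂ := emitAll_runs (h a) [] []
    rw [List.reverse_reverse, List.append_nil] at h₂
    have h₃ := eval_le_eval P (tsize_reverse (ea a) ▸ tsize_word (ea a))
    have h₄ := h₁.2 [] [] []
    rw [List.append_nil, List.append_nil] at h₄
    exact ((loadInput_runs ..).seq (h₄.seq h₂)).mono (by omega)
  have hst (w : List Γ') : st w ([] : List O) [] [] [] [] =
      @update Reg (fun k => List (Sym O k)) _ (fun _ => []) .inp w := by
    funext k
    cases k <;> rfl
  have hst' (w : List O) : st [] w [] [] [] [] =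
      @update Reg (fun k => List (Sym O k)) _ (fun _ => []) .out w := by
    funext k
    cases k <;> rfl
  let _ : Fintype (Sym O .inp) := inferInstanceAs (Fintype Γ')
  refine ⟨T, fun Q =>
    ⟨⟨⟨machine q .inp .out, Equiv.refl Γ', Equiv.refl O⟩, T + Q, fun a => ?_⟩, rfl⟩⟩
  have h₁ := key a
  rw [hst, hst'] at h₁
  have h₂ := Classical.choice h₁.machine_outputs
  have h₃ : 20 * (ea a).length + 6 * P.eval (10 * (ea a).length + 1) + 4 + 1 ≤
      (T + Q).eval (ea a).length := by
    simp [T]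
    omega
  refine cast ?_ (StateTransition.EvalsToInTime.mk h₂.toEvalsTo (h₂.steps_le_m.trans h₃))
  rw [TM2OutputsInTime]
  congr 2
  · exact (List.map_id _).symm
  · exact congrArg some (List.map_id _).symm

end StackProg

/-! ### Satisfying assignments of 2-CNF formulas -/

namespace TwoSat

open StackProg Polynomial

variable {V : Type}

/-- The negation of a literal; a literal is a variable with a sign. -/
def neg (a : V × Bool) : V × Bool := (a.1, !a.2)

/-- The literals of the given variables. -/
def lits (vs : List V) : List (V × Bool) := vs.flatMap fun v => [(v, true), (v, false)]

/-- The pairs of literals. -/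
def pairs (vs : List V) : List ((V × Bool) × (V × Bool)) :=
  (lits vs).flatMap fun a => (lits vs).map fun b => (a, b)

/-- The implications between literals given by the clauses; `cl a b` tells whether there is a clause
`a ∨ b`. -/
def imp (cl : V × Bool → V × Bool → Bool) (a b : V × Bool) : Bool :=
  cl (neg a) b || cl b (neg a)

@[simp] theorem neg_neg (a : V × Bool) : neg (neg a) = a := by simp [neg]

theorem mem_lits {vs : List V} {a : V × Bool} : a ∈ lits vs ↔ a.1 ∈ vs := by
  obtain ⟨v, _ | _⟩ := a <;> simp [lits]

theorem neg_mem_lits {vs : List V} {a : V × Bool} : neg a ∈ lits vs ↔ a ∈ lits vs := by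
  rw [mem_lits, mem_lits, neg]

theorem mem_pairs {vs : List V} {p : (V × Bool) × (V × Bool)} :
    p ∈ pairs vs ↔ p.1 ∈ lits vs ∧ p.2 ∈ lits vs := by
  obtain ⟨a, b⟩ := p
  simp [pairs]

theorem imp_contra (cl : V × Bool → V × Bool → Bool) (a b : V × Bool) :
    imp cl (neg b) (neg a) = imp cl a b := by
  simp [imp, Bool.or_comm]

/-- The implications between the literals of the given variables. -/
def Imp (cl : V × Bool → V × Bool → Bool) (vs : List V) (a b : V × Bool) : Prop :=
  a ∈ lits vs ∧ b ∈ lits vs ∧ imp cl a b = true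

theorem transGen_mem_lits {cl : V × Bool → V × Bool → Bool} {vs : List V}
    {a b : V × Bool} (h : Relation.TransGen (Imp cl vs) a b) : a ∈ lits vs ∧ b ∈ lits vs := by
  induction h with
  | single h => exact ⟨h.1, h.2.1⟩
  | tail _ h ih => exact ⟨ih.1, h.2.1⟩

@[fun_prop]
theorem pt_neg {γ : Type} [TreeCode γ] [TreeCode V] {a : γ → V × Bool} (ha : PT a) :
    PT fun c => neg (a c) := by
  unfold neg
  fun_prop

@[fun_prop]
theorem pt_lits {γ : Type} [TreeCode γ] [TreeCode V] {vs : γ → List V} (hv : PT vs) :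
    PT fun c => lits (vs c) := by
  unfold lits
  fun_prop

@[fun_prop]
theorem pt_pairs {γ : Type} [TreeCode γ] [TreeCode V] {vs : γ → List V} (hv : PT vs) :
    PT fun c => pairs (vs c) := by
  unfold pairs
  fun_prop

variable [DecidableEq V]

/-- One round of Warshall's algorithm: add the paths of length two through `m`. -/
def extend (vs : List V) (R : List ((V × Bool) × (V × Bool))) (m : V × Bool) :
    List ((V × Bool) × (V × Bool)) :=
  (pairs vs).filter fun p => decide (p ∈ R) || (decide ((p.1, m) ∈ R) && decide ((m, p.2) ∈ R))

/-- The transitive closure of the implications, by Warshall's algorithm. -/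
def closure (cl : V × Bool → V × Bool → Bool) (vs : List V) : List ((V × Bool) × (V × Bool)) :=
  (lits vs).foldl (extend vs) ((pairs vs).filter fun p => imp cl p.1 p.2)

/-- If neither the variable `v` nor its negation has been made true, make one of them true, together
with all literals that it implies. -/
def decideVar (vs : List V) (R : List ((V × Bool) × (V × Bool))) (S : List (V × Bool)) (v : V) :
    List (V × Bool) :=
  (lits vs).filter fun a => decide (a ∈ S) ||
    (!(decide ((v, true) ∈ S) || decide ((v, false) ∈ S)) &&
      (bif decide (((v, true), (v, false)) ∈ R) then
        decide (a = (v, false)) || decide (((v, false), a) ∈ R)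
      else decide (a = (v, true)) || decide (((v, true), a) ∈ R)))

/-- The literals that are made true. -/
def solve (cl : V × Bool → V × Bool → Bool) (vs : List V) : List (V × Bool) :=
  vs.foldl (decideVar vs (closure cl vs)) []

/-- The truth value of a literal. -/
def value (S : List (V × Bool)) (a : V × Bool) : Bool :=
  decide (decide ((a.1, true) ∈ S) = a.2)

theorem value_eq_true_iff {S : List (V × Bool)} {a : V × Bool} :
    value S a = true ↔ value S (a.1, true) = a.2 := by
  simp only [value, decide_eq_true_eq]

/-- Whether the assignment found satisfies all clauses. -/
def solved (cl : V × Bool → V × Bool → Bool) (vs : List V) : Bool :=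
  (pairs vs).all fun p => !cl p.1 p.2 || (value (solve cl vs) p.1 || value (solve cl vs) p.2)

section correctness

variable {cl : V × Bool → V × Bool → Bool} {vs : List V}

theorem mem_extend {R : List ((V × Bool) × (V × Bool))} {m a b : V × Bool} :
    (a, b) ∈ extend vs R m ↔ (a ∈ lits vs ∧ b ∈ lits vs) ∧
      ((a, b) ∈ R ∨ (a, m) ∈ R ∧ (m, b) ∈ R) := by
  simp [extend, mem_pairs]

theorem mem_closure {a b : V × Bool} :
    (a, b) ∈ closure cl vs ↔ Relation.TransGen (Imp cl vs) a b := by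
  have h₀ : ∀ a b, (a, b) ∈ (pairs vs).filter (fun p => imp cl p.1 p.2) ↔ Imp cl vs a b := by
    simp [mem_pairs, Imp, and_assoc]
  -- after some rounds, the relation is transitive at all literals already dealt with
  have key : ∀ (ms done : List (V × Bool)) (R : List ((V × Bool) × (V × Bool))),
      (∀ a b, (a, b) ∈ R → Relation.TransGen (Imp cl vs) a b) →
      (∀ a b, Imp cl vs a b → (a, b) ∈ R) →
      (∀ m ∈ done, ∀ a b, (a, m) ∈ R → (m, b) ∈ R → (a, b) ∈ R) →
      (∀ a b, (a, b) ∈ ms.foldl (extend vs) R → Relation.TransGen (Imp cl vs) a b) ∧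
      (∀ a b, Imp cl vs a b → (a, b) ∈ ms.foldl (extend vs) R) ∧
      ∀ m, m ∈ done ∨ m ∈ ms → ∀ a b, (a, m) ∈ ms.foldl (extend vs) R →
        (m, b) ∈ ms.foldl (extend vs) R → (a, b) ∈ ms.foldl (extend vs) R := by
    intro ms
    induction ms with
    | nil => exact fun done R h₁ h₂ h₃ => ⟨h₁, h₂, fun m hm => h₃ m (by simpa using hm)⟩
    | cons p ms ih =>
      intro done R h₁ h₂ h₃
      have e₁ : ∀ a b, (a, b) ∈ extend vs R p → Relation.TransGen (Imp cl vs) a b := by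
        intro a b h
        rcases (mem_extend.1 h).2 with h | h
        · exact h₁ a b h
        · exact (h₁ _ _ h.1).trans (h₁ _ _ h.2)
      have e₂ : ∀ a b, Imp cl vs a b → (a, b) ∈ extend vs R p :=
        fun a b h => mem_extend.2 ⟨⟨h.1, h.2.1⟩, .inl (h₂ a b h)⟩
      have e₃ : ∀ m ∈ p :: done, ∀ a b, (a, m) ∈ extend vs R p → (m, b) ∈ extend vs R p →
          (a, b) ∈ extend vs R p := by
        intro m hm a b ha hb
        rw [mem_extend] at ha hb ⊢
        refine ⟨⟨ha.1.1, hb.1.2⟩, ?_⟩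
        rcases List.mem_cons.1 hm with rfl | hm
        · tauto
        · have h₄ := h₃ m hm a b
          have h₅ := h₃ m hm a p
          have h₆ := h₃ m hm p b
          tauto
      obtain ⟨k₁, k₂, k₃⟩ := ih (p :: done) (extend vs R p) e₁ e₂ e₃
      refine ⟨k₁, k₂, fun m hm => k₃ m ?_⟩
      rcases hm with hm | hm
      · exact .inl (List.mem_cons_of_mem _ hm)
      · exact (List.mem_cons.1 hm).imp_left fun h => List.mem_cons.2 (.inl h)
  obtain ⟨k₁, k₂, k₃⟩ := key (lits vs) [] _ (fun a b h => .single ((h₀ a b).1 h))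
    (fun a b h => (h₀ a b).2 h) (by simp)
  refine ⟨k₁ a b, fun h => ?_⟩
  induction h with
  | single h => exact k₂ _ _ h
  | tail h h' ih => exact k₃ _ (.inr h'.1) _ _ ih (k₂ _ _ h')

theorem mem_closure_contra {a b : V × Bool} (h : (a, b) ∈ closure cl vs) :
    (neg b, neg a) ∈ closure cl vs := by
  rw [mem_closure] at *
  induction h with
  | single h =>
    exact .single ⟨neg_mem_lits.2 h.2.1, neg_mem_lits.2 h.1,
      (imp_contra ..).trans h.2.2⟩
  | tail _ h ih =>
    exact .head ⟨neg_mem_lits.2 h.2.1, neg_mem_lits.2 h.1,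
      (imp_contra ..).trans h.2.2⟩ ih

theorem closure_trans {a b c : V × Bool} (h : (a, b) ∈ closure cl vs)
    (h' : (b, c) ∈ closure cl vs) : (a, c) ∈ closure cl vs := by
  rw [mem_closure] at *
  exact h.trans h'

/-- Every satisfying assignment respects the transitive closure of the implications. -/
theorem closure_sound {Y : V → Bool} (hY : ∀ a ∈ lits vs, ∀ b ∈ lits vs, cl a b = true →
    Y a.1 = a.2 ∨ Y b.1 = b.2) {a b : V × Bool} (h : (a, b) ∈ closure cl vs) (ha : Y a.1 = a.2) :
    Y b.1 = b.2 := by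
  rw [mem_closure] at h
  have step : ∀ a b, Imp cl vs a b → Y a.1 = a.2 → Y b.1 = b.2 := by
    intro a b h ha
    have hn : neg a ∈ lits vs := neg_mem_lits.2 h.1
    have hn' : Y (neg a).1 ≠ (neg a).2 := by simp [neg, ha]
    rcases Bool.or_eq_true_iff.1 h.2.2 with h' | h'
    · exact (hY _ hn _ h.2.1 h').resolve_left hn'
    · exact (hY _ h.2.1 _ hn h').resolve_right hn'
  induction h with
  | single h => exact step _ _ h ha
  | tail _ h ih => exact step _ _ h ih

/-- The algorithm finds a satisfying assignment if there is one: an undecided variable `v` is made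
false if `v → ¬v` and true otherwise, and all literals implied by true ones are made true. No
conflict arises, since the implications are closed under contraposition and no variable has both
`v → ¬v` and `¬v → v`. -/
theorem solved_of_satisfiable {Y : V → Bool} (hY : ∀ a ∈ lits vs, ∀ b ∈ lits vs, cl a b = true →
    Y a.1 = a.2 ∨ Y b.1 = b.2) : solved cl vs = true := by
  have key : ∀ (us : List V) (S : List (V × Bool)), us ⊆ vs → (∀ a ∈ S, a ∈ lits vs) →
      (∀ a b, a ∈ S → (a, b) ∈ closure cl vs → b ∈ S) → (∀ a ∈ S, neg a ∉ S) →
      (∀ a ∈ S, a ∈ us.foldl (decideVar vs (closure cl vs)) S) ∧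
      (∀ a b, a ∈ us.foldl (decideVar vs (closure cl vs)) S → (a, b) ∈ closure cl vs →
        b ∈ us.foldl (decideVar vs (closure cl vs)) S) ∧
      (∀ a ∈ us.foldl (decideVar vs (closure cl vs)) S,
        neg a ∉ us.foldl (decideVar vs (closure cl vs)) S) ∧
      ∀ u ∈ us, (u, true) ∈ us.foldl (decideVar vs (closure cl vs)) S ∨
        (u, false) ∈ us.foldl (decideVar vs (closure cl vs)) S := by
    intro us
    induction us with
    | nil => exact fun S _ _ h₂ h₃ => ⟨fun _ h => h, h₂, h₃, by simp⟩
    | cons v us ih =>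
      intro S hu h₁ h₂ h₃
      have hv : v ∈ vs := hu List.mem_cons_self
      -- the literal `l` that is made true, unless `v` has been decided before
      obtain ⟨l, hl, hl', hS⟩ : ∃ l : V × Bool, l.1 = v ∧ (l, neg l) ∉ closure cl vs ∧
          ∀ a, a ∈ decideVar vs (closure cl vs) S v ↔ a ∈ S ∨ (l ∉ S ∧ neg l ∉ S) ∧
            (a = l ∨ (l, a) ∈ closure cl vs) := by
        by_cases h : ((v, true), (v, false)) ∈ closure cl vs
        · refine ⟨(v, false), rfl, fun h' => ?_, fun a => ?_⟩
          · have k₁ := closure_sound hY h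
            have k₂ := closure_sound hY h'
            cases hy : Y v <;> simp_all [neg]
          · have : a ∈ S → a ∈ lits vs := h₁ a
            have : (((v, false), a) ∈ closure cl vs) → a ∈ lits vs := fun h =>
              (transGen_mem_lits (mem_closure.1 h)).2
            have : a = (v, false) → a ∈ lits vs := fun h => mem_lits.2 (h ▸ hv)
            simp [decideVar, h, neg]
            tauto
        · refine ⟨(v, true), rfl, h, fun a => ?_⟩
          have : a ∈ S → a ∈ lits vs := h₁ a
          have : (((v, true), a) ∈ closure cl vs) → a ∈ lits vs := fun h =>
            (transGen_mem_lits (mem_closure.1 h)).2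
          have : a = (v, true) → a ∈ lits vs := fun h => mem_lits.2 (h ▸ hv)
          simp [decideVar, h, neg]
          tauto
      have e₁ : ∀ a ∈ decideVar vs (closure cl vs) S v, a ∈ lits vs :=
        fun a ha => (List.mem_filter.1 ha).1
      have e₂ : ∀ a b, a ∈ decideVar vs (closure cl vs) S v → (a, b) ∈ closure cl vs →
          b ∈ decideVar vs (closure cl vs) S v := by
        intro a b ha hab
        rw [hS] at ha ⊢
        rcases ha with ha | ⟨hn, rfl | ha⟩
        · exact .inl (h₂ a b ha hab)
        · exact .inr ⟨hn, .inr hab⟩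
        · exact .inr ⟨hn, .inr (closure_trans ha hab)⟩
      have e₃ : ∀ a ∈ decideVar vs (closure cl vs) S v,
          neg a ∉ decideVar vs (closure cl vs) S v := by
        intro a ha hna
        rw [hS] at ha hna
        rcases ha with ha | ⟨hn, ha⟩ <;> rcases hna with hna | ⟨hn', hna⟩
        · exact h₃ a ha hna
        · -- `l = ¬a` or `l → ¬a`, so `¬l` is among the literals that were true before
          rcases hna with hna | hna
          · exact hn'.2 (by rwa [← hna, neg_neg])
          · have := mem_closure_contra hna
            rw [neg_neg] at this
            exact hn'.2 (h₂ _ _ ha this)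
        · rcases ha with rfl | ha
          · exact hn.2 hna
          · exact hn.2 (h₂ _ _ hna (mem_closure_contra ha))
        · -- `l → a` and `l → ¬a` imply `l → ¬l`
          rcases ha with rfl | ha <;> rcases hna with hna | hna
          · exact absurd (congrArg Prod.snd hna) (by simp [neg])
          · exact hl' hna
          · rw [← neg_neg a, hna] at ha
            exact hl' ha
          · have := mem_closure_contra hna
            rw [neg_neg] at this
            exact hl' (closure_trans ha this)
      obtain ⟨k₁, k₂, k₃, k₄⟩ := ih (decideVar vs (closure cl vs) S v)
        (fun x hx => hu (List.mem_cons_of_mem _ hx)) e₁ e₂ e₃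
      refine ⟨fun a ha => k₁ a ((hS a).2 (.inl ha)), k₂, k₃, fun u hu => ?_⟩
      rcases List.mem_cons.1 hu with rfl | hu
      · have hd : l ∈ decideVar vs (closure cl vs) S u ∨
            neg l ∈ decideVar vs (closure cl vs) S u := by
          rw [hS, hS]
          tauto
        subst hl
        obtain ⟨x, _ | _⟩ := l
        · exact hd.symm.imp (k₁ _) (k₁ _)
        · exact hd.imp (k₁ _) (k₁ _)
      · exact k₄ u hu
  obtain ⟨-, k₂, k₃, k₄⟩ := key vs [] (List.Subset.refl _) (by simp) (by simp) (by simp)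
  have hval : ∀ a ∈ lits vs, value (solve cl vs) a = true ↔ a ∈ solve cl vs := by
    intro a ha
    have h₄ := k₄ a.1 (mem_lits.1 ha)
    change (a.1, true) ∈ solve cl vs ∨ (a.1, false) ∈ solve cl vs at h₄
    obtain ⟨v, _ | _⟩ := a
    · have h₃ : (v, true) ∈ solve cl vs → (v, false) ∉ solve cl vs := k₃ (v, true)
      simp only [value, decide_eq_true_eq, decide_eq_false_iff_not]
      tauto
    · simp [value]
  rw [solved, List.all_eq_true]
  rintro ⟨a, b⟩ hab
  obtain ⟨ha, hb⟩ := mem_pairs.1 hab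
  simp only [Bool.or_eq_true, Bool.not_eq_true', hval a ha, hval b hb]
  by_cases hc : cl a b = true
  · by_cases has : a ∈ solve cl vs
    · exact .inr (.inl has)
    · have hn : neg a ∈ solve cl vs := by
        have h₄ := k₄ a.1 (mem_lits.1 ha)
        change (a.1, true) ∈ solve cl vs ∨ (a.1, false) ∈ solve cl vs at h₄
        obtain ⟨v, _ | _⟩ := a
        · exact h₄.resolve_right has
        · exact h₄.resolve_left has
      refine .inr (.inr (k₂ _ _ hn (mem_closure.2 (.single ⟨neg_mem_lits.2 ha, hb, ?_⟩))))
      simp [imp, hc]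
  · exact .inl (by simpa using hc)

end correctness

section polynomialTime

variable {γ : Type} [TreeCode γ] [TreeCode V]

@[fun_prop]
theorem pt_closure {cl : γ → V × Bool → V × Bool → Bool} {vs : γ → List V}
    (hc : PT fun z : γ × (V × Bool) × (V × Bool) => cl z.1 z.2.1 z.2.2) (hv : PT vs) :
    PT fun c => closure (cl c) (vs c) := by
  obtain ⟨P, hP⟩ := (pt_pairs hv).tsize_le
  have hi : PT fun z : γ × (V × Bool) × (V × Bool) => imp (cl z.1) z.2.1 z.2.2 := by
    unfold imp
    exact PT.or (hc.comp (f := fun z : γ × (V × Bool) × (V × Bool) => (z.1, neg z.2.1, z.2.2))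
      (by fun_prop)) (hc.comp
      (f := fun z : γ × (V × Bool) × (V × Bool) => (z.1, z.2.2, neg z.2.1)) (by fun_prop))
  refine PT.foldl (step := fun c => extend (vs c)) (pt_lits hv) (PT.filter (pt_pairs hv) hi) ?_ P
    fun c m _ => ?_
  · unfold extend
    fun_prop
  · refine le_trans (tsize_le_of_sublist ?_) (hP c)
    rcases List.eq_nil_or_concat m with rfl | ⟨m, a, rfl⟩
    · exact List.filter_sublist
    · rw [List.concat_eq_append, List.foldl_append]
      exact List.filter_sublist

@[fun_prop]
theorem pt_solve {cl : γ → V × Bool → V × Bool → Bool} {vs : γ → List V}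
    (hc : PT fun z : γ × (V × Bool) × (V × Bool) => cl z.1 z.2.1 z.2.2) (hv : PT vs) :
    PT fun c => solve (cl c) (vs c) := by
  obtain ⟨P, hP⟩ := (pt_lits hv).tsize_le
  have hR := pt_closure hc hv
  refine PT.foldl (step := fun c => decideVar (vs c) (closure (cl c) (vs c))) hv (PT.const []) ?_ P
    fun c m _ => ?_
  · have h : PT fun z : (γ × List ((V × Bool) × (V × Bool))) × List (V × Bool) × V =>
        decideVar (vs z.1.1) z.1.2 z.2.1 z.2.2 := by
      unfold decideVar
      fun_prop
    exact h.comp (f := fun z : γ × List (V × Bool) × V =>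
      ((z.1, closure (cl z.1) (vs z.1)), z.2.1, z.2.2)) (by fun_prop)
  · refine le_trans (tsize_le_of_sublist ?_) (hP c)
    rcases List.eq_nil_or_concat m with rfl | ⟨m, a, rfl⟩
    · exact List.nil_sublist _
    · rw [List.concat_eq_append, List.foldl_append]
      exact List.filter_sublist

@[fun_prop]
theorem pt_solved {cl : γ → V × Bool → V × Bool → Bool} {vs : γ → List V}
    (hc : PT fun z : γ × (V × Bool) × (V × Bool) => cl z.1 z.2.1 z.2.2) (hv : PT vs) :
    PT fun c => solved (cl c) (vs c) := by
  have hS := pt_solve hc hv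
  have h : PT fun z : γ × List (V × Bool) => (pairs (vs z.1)).all fun p =>
      !cl z.1 p.1 p.2 || (value z.2 p.1 || value z.2 p.2) := by
    have hc' : PT fun z : (γ × List (V × Bool)) × (V × Bool) × (V × Bool) => cl z.1.1 z.2.1 z.2.2 :=
      hc.comp (f := fun z : (γ × List (V × Bool)) × (V × Bool) × (V × Bool) =>
        (z.1.1, z.2.1, z.2.2)) (by fun_prop)
    unfold value
    fun_prop
  exact h.comp (f := fun c => (c, solve (cl c) (vs c))) (by fun_prop)

end polynomialTime

end TwoSat

/-! ### The algorithm -/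

namespace CombDMR

open Computability StackProg

/-- Tables of binary numerals, as lists of rows. -/
abbrev Table : Type := List (List (List Bool))

/-- One step of reading an instance from its end: the state consists of the bits of the current
entry, the entries of the current row, and the finished rows. -/
def readStep (s : List Bool × List (List Bool) × Table) (x : Γ') :
    List Bool × List (List Bool) × Table :=
  bif decide (x = .bit true) then (true :: s.1, s.2)
  else bif decide (x = .bit false) then (false :: s.1, s.2)
  else bif decide (x = .comma) then ([], s.1 :: s.2.1, s.2.2)
  else bif decide (x = .bra) then ([], [], s.2.1 :: s.2.2)
  else s

/-- The table given by the reversed word of an instance. -/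
def readTable (w : List Γ') : Table := (w.foldl readStep ([], [], [])).2.2

/-- The entry in row `i` and column `j`. -/
def entry (T : Table) (i j : ℕ) : List Bool := (T.getD i []).getD j []

/-- The successor of a binary numeral, with the least significant bit first. -/
def binSucc (l : List Bool) : List Bool :=
  let s := l.foldl (fun (s : List Bool × Bool) b => (Bool.xor b s.2 :: s.1, b && s.2)) ([], true)
  (bif s.2 then true :: s.1 else s.1).reverse

/-- Whether two binary numerals differ by at most `c`. -/
def near : ℕ → List Bool → List Bool → Bool
  | 0, x, y => decide (x = y)
  | c + 1, x, y => near c x y || (decide (x = binSucc^[c + 1] y) || decide (y = binSucc^[c + 1] x))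

/-- Whether the entry is the number `c`. -/
def isNum (T : Table) (c i j : ℕ) : Bool := decide (entry T i j = encodeNat c)

/-- Whether the entry is at most `q`. -/
def isSmall (T : Table) (q i j : ℕ) : Bool :=
  decide (entry T i j ∈ (List.range (q + 1)).map encodeNat)

/-- The triangle inequality for all triangles with a side of length `c`. -/
def triangles (T : Table) (c : ℕ) : Bool :=
  (List.range T.length).all fun i => (List.range T.length).all fun w =>
    !isNum T c i w || (List.range T.length).all fun j => near c (entry T i j) (entry T w j)

/-- The vertex `w` has distance `c` to `i`, and lies on a shortest path from `i` to `j`. -/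
def between (T : Table) (c i w j : ℕ) : Bool :=
  isNum T c i w && decide (entry T i j = binSucc^[c] (entry T w j))

/-- Whether the table is a distance matrix that equals the distance matrix of its `2`-skeleton (or
of its `3`-skeleton, if `b` is true). This is a local condition: the triangle inequality has to be
checked for triangles with an edge of the skeleton, and if the entry of `i` and `j` is large, some
edge of the skeleton at `i` leads towards `j`. -/
def isSkeletal (b : Bool) (T : Table) : Bool :=
  ((List.range T.length).all fun i => (List.range T.length).all fun j =>
    decide (isNum T 0 i j = decide (i = j)) && decide (entry T i j = entry T j i)) &&
  ((triangles T 1 && triangles T 2 && (!b || triangles T 3)) &&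
  ((List.range T.length).all fun i => (List.range T.length).all fun j =>
    (bif b then isSmall T 3 i j else isSmall T 2 i j) || (List.range T.length).any fun w =>
      between T 1 i w j || between T 2 i w j || (b && between T 3 i w j)))

/-- The indices `i` and `j` have distance two, but no common neighbour in the `1`-skeleton. -/
def lacksTwo (T : Table) (i j : ℕ) : Bool :=
  isNum T 2 i j && !(List.range T.length).any fun w => isNum T 1 i w && isNum T 1 w j

/-- The indices `i` and `j` have distance three, but no path of length three in the
`2`-skeleton. -/
def lacksThree (T : Table) (i j : ℕ) : Bool :=
  isNum T 3 i j && !(List.range T.length).any fun w =>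
    (isNum T 1 i w && isNum T 2 w j) || (isNum T 2 i w && isNum T 1 w j)

/-- The clauses of the formula `φ₂` (or `φ₂′`, if `b` is true). A literal `((i, e), s)` belongs to
the variable of the index `i` and the extra vertex `e`, and has the sign `s`. -/
def isClause (b : Bool) (T : Table) (x y : (ℕ × Bool) × Bool) : Bool :=
  ((!x.2 && !y.2) && (bif decide (x.1.2 = y.1.2) then !isSmall T 2 x.1.1 y.1.1
    else b && !isSmall T 3 x.1.1 y.1.1)) ||
  ((x.2 && y.2) && (bif decide (x.1.2 = y.1.2) then b && lacksThree T x.1.1 y.1.1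
    else lacksTwo T x.1.1 y.1.1 || (decide (x.1.1 = y.1.1) && (List.range T.length).any fun j =>
      lacksTwo T x.1.1 j || (b && lacksThree T x.1.1 j))))

/-- The variables. -/
def vars (T : Table) : List (ℕ × Bool) :=
  (List.range T.length).flatMap fun i => [(i, false), (i, true)]

/-- Whether the algorithm finds a realisation in which the extra vertices are adjacent iff `b`. -/
def succeeds (b : Bool) (T : Table) : Bool :=
  isSkeletal b T && TwoSat.solved (isClause b T) (vars T)

/-- The literals made true by the algorithm for 2-CNF formulas. -/
def trueLits (b : Bool) (T : Table) : List ((ℕ × Bool) × Bool) :=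
  TwoSat.solve (isClause b T) (vars T)

/-- The vertices of the graph: `inl i` is represented by `(false, i, false)`, and `inr e` by
`(true, 0, e)`. -/
def verts (T : Table) : List (Bool × ℕ × Bool) :=
  (List.range T.length).map (fun i => (false, i, false)) ++ [(true, 0, false), (true, 0, true)]

/-- The adjacency of the graph given by the literals in `S`. -/
def isAdj (b : Bool) (T : Table) (S : List ((ℕ × Bool) × Bool)) (u v : Bool × ℕ × Bool) : Bool :=
  bif u.1 then
    bif v.1 then b && !decide (u.2.2 = v.2.2) else decide (((v.2.1, u.2.2), true) ∈ S)
  else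
    bif v.1 then decide (((u.2.1, v.2.2), true) ∈ S) else isNum T 1 u.2.1 v.2.1

/-- The letters of the output: the numbers `0` and `1` stand for bits, and the numbers `2` and `3`
for brackets. -/
def graphWord (b : Bool) (T : Table) : List ℕ :=
  1 :: (verts T).flatMap fun u =>
    2 :: (((verts T).map fun v => bif isAdj b T (trueLits b T) u v then 1 else 0) ++ [3])

/-- The reversed output of the construction algorithm, for a reversed input word. -/
def constructWord (w : List Γ') : List ℕ :=
  (bif succeeds false (readTable w) then graphWord false (readTable w)
    else bif succeeds true (readTable w) then graphWord true (readTable w) else [0]).reverse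

/-- The output of the decision algorithm, for a reversed input word. -/
def decideWord (w : List Γ') : List ℕ :=
  [bif succeeds false (readTable w) || succeeds true (readTable w) then 1 else 0]

/-! ### The algorithm takes polynomial time -/

section polynomialTime

variable {γ : Type} [TreeCode γ]

theorem pt_readTable : PT readTable := by
  refine PT.comp (g := fun s : List Bool × List (List Bool) × Table => s.2.2) (by fun_prop)
    (PT.foldl_of_add (γ := List Γ') (l := fun w => w) (init := fun _ => ([], [], []))
      (step := fun _ => readStep) (by fun_prop) (by fun_prop) (by unfold readStep; fun_prop) 5
      fun w x _ s => ?_)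
  obtain ⟨a, b, c⟩ := s
  have := tsize_bool true
  have := tsize_bool false
  rcases x with _ | (_ | _) | _ | _ | _ <;> simp [readStep] <;> omega

@[fun_prop]
theorem pt_entry {T : γ → Table} {i j : γ → ℕ} (hT : PT T) (hi : PT i) (hj : PT j) :
    PT fun c => entry (T c) (i c) (j c) := by
  unfold entry
  fun_prop

@[fun_prop]
theorem pt_binSucc {l : γ → List Bool} (hl : PT l) : PT fun c => binSucc (l c) := by
  unfold binSucc
  have h : PT fun c => (l c).foldl
      (fun (s : List Bool × Bool) b => (Bool.xor b s.2 :: s.1, b && s.2)) ([], true) := by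
    refine PT.foldl_of_add (step := fun _ (s : List Bool × Bool) b =>
      (Bool.xor b s.2 :: s.1, b && s.2)) hl (PT.const _) (by fun_prop) 7 fun c b _ s => ?_
    have h₁ := tsize_bool (Bool.xor b s.2)
    have h₂ := tsize_bool (b && s.2)
    simp only [tsize_prod, tsize_cons, Polynomial.eval_ofNat]
    omega
  fun_prop

@[fun_prop]
theorem pt_binSucc_iterate (k : ℕ) {l : γ → List Bool} (hl : PT l) :
    PT fun c => binSucc^[k] (l c) := by
  induction k with
  | zero => exact hl
  | succ k ih =>
    simp only [Function.iterate_succ_apply']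
    fun_prop

@[fun_prop]
theorem pt_near (k : ℕ) {l m : γ → List Bool} (hl : PT l) (hm : PT m) :
    PT fun c => near k (l c) (m c) := by
  induction k with
  | zero => exact hl.decide_eq hm
  | succ k ih =>
    unfold near
    fun_prop

@[fun_prop]
theorem pt_isNum (k : ℕ) {T : γ → Table} {i j : γ → ℕ} (hT : PT T) (hi : PT i) (hj : PT j) :
    PT fun c => isNum (T c) k (i c) (j c) := by
  unfold isNum
  fun_prop

@[fun_prop]
theorem pt_isSmall (k : ℕ) {T : γ → Table} {i j : γ → ℕ} (hT : PT T) (hi : PT i) (hj : PT j) :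
    PT fun c => isSmall (T c) k (i c) (j c) := by
  unfold isSmall
  exact (pt_entry hT hi hj).decide_mem (PT.const _)

@[fun_prop]
theorem pt_triangles (k : ℕ) {T : γ → Table} (hT : PT T) : PT fun c => triangles (T c) k := by
  unfold triangles
  fun_prop

@[fun_prop]
theorem pt_between (k : ℕ) {T : γ → Table} {i w j : γ → ℕ} (hT : PT T) (hi : PT i) (hw : PT w)
    (hj : PT j) : PT fun c => between (T c) k (i c) (w c) (j c) := by
  unfold between
  fun_prop

@[fun_prop]
theorem pt_isSkeletal (b : Bool) {T : γ → Table} (hT : PT T) : PT fun c => isSkeletal b (T c) := by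
  unfold isSkeletal
  fun_prop

@[fun_prop]
theorem pt_lacksTwo {T : γ → Table} {i j : γ → ℕ} (hT : PT T) (hi : PT i) (hj : PT j) :
    PT fun c => lacksTwo (T c) (i c) (j c) := by
  unfold lacksTwo
  fun_prop

@[fun_prop]
theorem pt_lacksThree {T : γ → Table} {i j : γ → ℕ} (hT : PT T) (hi : PT i) (hj : PT j) :
    PT fun c => lacksThree (T c) (i c) (j c) := by
  unfold lacksThree
  fun_prop

@[fun_prop]
theorem pt_isClause (b : Bool) {T : γ → Table} {x y : γ → (ℕ × Bool) × Bool} (hT : PT T)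
    (hx : PT x) (hy : PT y) : PT fun c => isClause b (T c) (x c) (y c) := by
  unfold isClause
  fun_prop

@[fun_prop]
theorem pt_vars {T : γ → Table} (hT : PT T) : PT fun c => vars (T c) := by
  unfold vars
  fun_prop

@[fun_prop]
theorem pt_succeeds (b : Bool) {T : γ → Table} (hT : PT T) : PT fun c => succeeds b (T c) := by
  unfold succeeds
  fun_prop

@[fun_prop]
theorem pt_trueLits (b : Bool) {T : γ → Table} (hT : PT T) : PT fun c => trueLits b (T c) := by
  unfold trueLits
  fun_prop

@[fun_prop]
theorem pt_verts {T : γ → Table} (hT : PT T) : PT fun c => verts (T c) := by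
  unfold verts
  fun_prop

@[fun_prop]
theorem pt_isAdj (b : Bool) {T : γ → Table} {S : γ → List ((ℕ × Bool) × Bool)}
    {u v : γ → Bool × ℕ × Bool} (hT : PT T) (hS : PT S) (hu : PT u) (hv : PT v) :
    PT fun c => isAdj b (T c) (S c) (u c) (v c) := by
  unfold isAdj
  fun_prop

@[fun_prop]
theorem pt_graphWord (b : Bool) {T : γ → Table} (hT : PT T) : PT fun c => graphWord b (T c) := by
  unfold graphWord
  fun_prop

theorem pt_constructWord : PT constructWord := by
  have := pt_readTable
  unfold constructWord
  fun_prop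

theorem pt_decideWord : PT decideWord := by
  have := pt_readTable
  unfold decideWord
  fun_prop

end polynomialTime

end CombDMR

/-! ### Skeleton distances -/

namespace CombDMR

open SimpleGraph

variable {n : ℕ} {D : Matrix (Fin n) (Fin n) ℕ} {q : ℕ}

/-- The length of a walk in a skeleton of `D`, where the edges have the lengths given by `D`. -/
def walkLength (D : Matrix (Fin n) (Fin n) ℕ) {i j : Fin n} (p : (skeleton D q).Walk i j) : ℕ :=
  (p.darts.map fun d => D d.fst d.snd).sum

@[simp] theorem walkLength_nil (i : Fin n) :
    walkLength D (Walk.nil : (skeleton D q).Walk i i) = 0 := rfl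

@[simp] theorem walkLength_cons {i j k : Fin n} (h : (skeleton D q).Adj i k)
    (p : (skeleton D q).Walk k j) : walkLength D (.cons h p) = D i k + walkLength D p := by
  simp [walkLength]

theorem skeletonDist_eq (i j : Fin n) :
    skeletonDist D q i j = ⨅ p : (skeleton D q).Walk i j, (walkLength D p : ℕ∞) := by
  refine iInf_congr fun p => ?_
  rw [walkLength]
  induction p.darts with
  | nil => simp
  | cons d l ih => simp [ih]

theorem skeletonDist_le_walkLength {i j : Fin n} (p : (skeleton D q).Walk i j) :
    skeletonDist D q i j ≤ walkLength D p := by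
  rw [skeletonDist_eq]
  exact iInf_le _ p

theorem exists_walk_of_skeletonDist_le {i j : Fin n} {m : ℕ} (h : skeletonDist D q i j ≤ m) :
    ∃ p : (skeleton D q).Walk i j, walkLength D p ≤ m := by
  have h' : skeletonDist D q i j < (m + 1 : ℕ) := h.trans_lt (by exact_mod_cast Nat.lt_succ_self m)
  rw [skeletonDist_eq, iInf_lt_iff] at h'
  obtain ⟨p, hp⟩ := h'
  exact ⟨p, Nat.lt_succ_iff.1 (by exact_mod_cast hp)⟩

theorem skeletonDist_self (i : Fin n) : skeletonDist D q i i = 0 := by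
  simpa using skeletonDist_le_walkLength (D := D) (q := q) (Walk.nil' i)

theorem skeleton_adj_of_le {i k : Fin n} (hik : i ≠ k) (h : D i k ≤ q) :
    (skeleton D q).Adj i k := by
  rw [skeleton, fromRel_adj]
  exact ⟨hik, .inl h⟩

theorem skeletonDist_le_add {i j k : Fin n} {m : ℕ} (h : D i k ≤ m) (hm : m ≤ q) :
    skeletonDist D q i j ≤ m + skeletonDist D q k j := by
  by_cases hik : i = k
  · subst hik
    exact le_add_self
  rw [skeletonDist_eq k, ENat.add_iInf]
  refine le_iInf fun p => (skeletonDist_le_walkLength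
    (.cons (skeleton_adj_of_le hik (h.trans hm)) p)).trans ?_
  rw [walkLength_cons, Nat.cast_add]
  gcongr

theorem skeletonDist_le_of_le {i j : Fin n} {m : ℕ} (h : D i j ≤ m) (hm : m ≤ q) :
    skeletonDist D q i j ≤ m := by
  simpa [skeletonDist_self] using skeletonDist_le_add (j := j) h hm

namespace IsDistanceMatrix

variable (hD : IsDistanceMatrix D)
include hD

theorem adj_iff {i j : Fin n} : (skeleton D q).Adj i j ↔ i ≠ j ∧ D i j ≤ q := by
  rw [skeleton, fromRel_adj, hD.symm j i, or_self]

theorem adj_one_iff {i j : Fin n} : (skeleton D 1).Adj i j ↔ D i j = 1 := by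
  rw [hD.adj_iff]
  constructor
  · rintro ⟨h, h'⟩
    have := hD.pos i j h
    omega
  · intro h
    refine ⟨?_, h.le⟩
    rintro rfl
    simp [hD.diag] at h

theorem eq_of_eq_zero {i j : Fin n} (h : D i j = 0) : i = j := by
  by_contra hij
  exact (hD.pos i j hij).ne' h

theorem le_walkLength {i j : Fin n} (p : (skeleton D q).Walk i j) : D i j ≤ walkLength D p := by
  induction p with
  | nil => simp [hD.diag]
  | @cons i k j h p ih =>
    have := hD.triangle i j k
    rw [walkLength_cons]
    omega

theorem le_skeletonDist (i j : Fin n) : (D i j : ℕ∞) ≤ skeletonDist D q i j := by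
  rw [skeletonDist_eq]
  exact le_iInf fun p => by exact_mod_cast hD.le_walkLength p

/-- For distance two, a path of length at most two in the `1`-skeleton is a common neighbour. -/
theorem two_lt_edist_iff {i j : Fin n} (hij : D i j = 2) :
    2 < (skeleton D 1).edist i j ↔ ∀ w, ¬ (D i w = 1 ∧ D w j = 1) := by
  have hne : i ≠ j := by
    rintro rfl
    simp [hD.diag] at hij
  rw [SimpleGraph.two_lt_edist_iff, hD.adj_one_iff, hij, Set.eq_empty_iff_forall_notMem]
  simp only [hne, ne_eq, not_false_eq_true, OfNat.ofNat_ne_one, true_and, mem_commonNeighbors,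
    hD.adj_one_iff, hD.symm j]

/-- For distance three, a path of length at most three in the `2`-skeleton has an inner vertex at
distances one and two from its ends. -/
theorem three_lt_skeletonDist_iff {i j : Fin n} (hij : D i j = 3) :
    3 < skeletonDist D 2 i j ↔
      ∀ w, ¬ (D i w = 1 ∧ D w j = 2 ∨ D i w = 2 ∧ D w j = 1) := by
  constructor
  · rintro h w hw
    refine h.not_ge ?_
    have h₁ : skeletonDist D 2 i j ≤ D i w + skeletonDist D 2 w j :=
      skeletonDist_le_add le_rfl (by omega)
    have h₂ : skeletonDist D 2 w j ≤ D w j := skeletonDist_le_of_le le_rfl (by omega)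
    have h₃ : (D i w : ℕ∞) + D w j = 3 := by
      have : D i w + D w j = 3 := by omega
      exact_mod_cast this
    calc _ ≤ _ := h₁
      _ ≤ (D i w : ℕ∞) + D w j := by gcongr
      _ = 3 := h₃
  · intro h
    by_contra hlt
    obtain ⟨p, hp⟩ := exists_walk_of_skeletonDist_le (m := 3) (not_lt.1 hlt)
    cases p with
    | nil => simp [hD.diag] at hij
    | @cons _ w _ ha p =>
      rw [walkLength_cons] at hp
      have h₁ := hD.le_walkLength p
      have h₂ := (hD.adj_iff.1 ha).2
      have h₃ := hD.pos i w (hD.adj_iff.1 ha).1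
      have h₄ := hD.triangle i j w
      have h₅ := h w
      omega

end IsDistanceMatrix

/-- A local condition for a matrix to be a distance matrix that equals the distance matrix of its
`q`-skeleton. -/
structure IsSkeletalMatrix (D : Matrix (Fin n) (Fin n) ℕ) (q : ℕ) : Prop where
  eq_zero_iff : ∀ i j, D i j = 0 ↔ i = j
  symm : ∀ i j, D i j = D j i
  triangle : ∀ i w j, 1 ≤ D i w → D i w ≤ q → D i j ≤ D w j + D i w
  exists_between : ∀ i j, q < D i j → ∃ w, 1 ≤ D i w ∧ D i w ≤ q ∧ D i j = D w j + D i w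

theorem IsSkeletalMatrix.isDistanceMatrix (h : IsSkeletalMatrix D q) : IsDistanceMatrix D where
  diag i := (h.eq_zero_iff i i).2 rfl
  pos i j hij := Nat.pos_of_ne_zero fun h' => hij ((h.eq_zero_iff i j).1 h')
  symm := h.symm
  triangle i j w := by
    -- a long side of the triangle is split at a vertex provided by `exists_between`
    induction hd : D i w using Nat.strong_induction_on generalizing i with
    | _ m ih =>
      subst hd
      rcases Nat.eq_zero_or_pos (D i w) with h₀ | h₀
      · rw [(h.eq_zero_iff i w).1 h₀]
        omega
      rcases le_or_gt (D i w) q with h₁ | h₁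
      · have := h.triangle i w j h₀ h₁
        omega
      · obtain ⟨u, hu₁, hu₂, hu⟩ := h.exists_between i w h₁
        have h₂ := h.triangle i u j hu₁ hu₂
        have h₃ := ih (D u w) (by omega) u rfl
        omega

/-- If `D` is given by distances in the skeleton, the first step of a shortest path from `i` to `j`
leads to a vertex as in `exists_between`. -/
theorem isSkeletalMatrix_iff :
    IsSkeletalMatrix D q ↔ IsDistanceMatrix D ∧ ∀ i j, skeletonDist D q i j = (D i j : ℕ∞) := by
  constructor
  · refine fun h => ⟨h.isDistanceMatrix, fun i j =>
      le_antisymm ?_ (h.isDistanceMatrix.le_skeletonDist i j)⟩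
    induction hd : D i j using Nat.strong_induction_on generalizing i with
    | _ m ih =>
      subst hd
      rcases le_or_gt (D i j) q with h₁ | h₁
      · exact skeletonDist_le_of_le le_rfl h₁
      · obtain ⟨u, hu₁, hu₂, hu⟩ := h.exists_between i j h₁
        have h₂ := ih (D u j) (by omega) u rfl
        calc _ ≤ (D i u : ℕ∞) + skeletonDist D q u j := skeletonDist_le_add le_rfl hu₂
          _ ≤ (D i u : ℕ∞) + D u j := by gcongr
          _ = (D i j : ℕ∞) := by rw [hu, Nat.cast_add, add_comm]
  · rintro ⟨hD, h⟩
    refine ⟨fun i j => ⟨hD.eq_of_eq_zero, fun h => h ▸ hD.diag i⟩, hD.symm, fun i w j _ _ => ?_,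
      fun i j hij => ?_⟩
    · have := hD.triangle i j w
      omega
    · obtain ⟨p, hp⟩ := exists_walk_of_skeletonDist_le (h i j).le
      cases p with
      | nil => simp [hD.diag] at hij
      | @cons _ w _ ha p =>
        rw [walkLength_cons] at hp
        have h₁ := hD.le_walkLength p
        have h₂ := hD.adj_iff.1 ha
        have h₃ := hD.pos i w h₂.1
        have h₄ := hD.triangle i j w
        exact ⟨w, h₃, h₂.2, by omega⟩

/-! ### The distances of the candidate graphs -/

variable {X : EdgeVar n → Bool}

/-- The four clauses of `φ₂` for `D i j = 2` ask for an extra vertex adjacent to `i` and `j`. -/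
theorem satisfies_phi₂_iff : Satisfies X (phi₂ D) ↔
    (∀ i j, 2 < D i j → ∀ e, X (i, e) = true → X (j, e) = true → False) ∧
    ∀ i j, D i j = 2 → 2 < (skeleton D 1).edist i j →
      ∃ e, X (i, e) = true ∧ X (j, e) = true := by
  constructor
  · intro h
    refine ⟨fun i j hij e h₁ h₂ => ?_, fun i j hij hs => ?_⟩
    · have := h (neg i e, neg j e) (.inl ⟨i, j, hij, by
        fin_cases e
        · exact .inl rfl
        · exact .inr rfl⟩)
      simp [neg, h₁, h₂] at this
    · have k := fun c hc => h c (.inr ⟨i, j, hij, hs, hc⟩)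
      have k₁ := k _ (.inl rfl)
      have k₂ := k _ (.inr (.inl rfl))
      have k₃ := k _ (.inr (.inr (.inl rfl)))
      have k₄ := k _ (.inr (.inr (.inr rfl)))
      simp only [pos] at k₁ k₂ k₃ k₄
      rw [Fin.exists_fin_two]
      tauto
  · rintro ⟨h₁, h₂⟩ c (⟨i, j, hij, hc⟩ | ⟨i, j, hij, hs, hc⟩)
    · have k₀ := h₁ i j hij 0
      have k₁ := h₁ i j hij 1
      rcases hc with rfl | rfl <;> simp only [neg, ← Bool.not_eq_true] <;> tauto
    · have k := h₂ i j hij hs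
      rw [Fin.exists_fin_two] at k
      rcases hc with rfl | rfl | rfl | rfl <;> simp only [pos] <;> tauto

/-- The four additional clauses of `φ₂′` for `D i j = 3` ask for two different extra vertices,
adjacent to `i` and `j` respectively. -/
theorem satisfies_phi₂'_iff : Satisfies X (phi₂' D) ↔ Satisfies X (phi₂ D) ∧
    (∀ i j, 3 < D i j → ∀ e e', e ≠ e' → X (i, e) = true → X (j, e') = true → False) ∧
    ∀ i j, D i j = 3 → 3 < skeletonDist D 2 i j →
      ∃ e e', e ≠ e' ∧ X (i, e) = true ∧ X (j, e') = true := by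
  constructor
  · intro h
    refine ⟨fun c hc => h c (.inl (.inl hc)), fun i j hij e e' he h₁ h₂ => ?_, fun i j hij hs => ?_⟩
    · have := h (neg i e, neg j e') (.inl (.inr ⟨i, j, hij, by
        fin_cases e <;> fin_cases e'
        · exact absurd rfl he
        · exact .inl rfl
        · exact .inr rfl
        · exact absurd rfl he⟩))
      simp [neg, h₁, h₂] at this
    · have k := fun c hc => h c (.inr ⟨i, j, hij, hs, hc⟩)
      have k₁ := k _ (.inl rfl)
      have k₂ := k _ (.inr (.inl rfl))
      have k₃ := k _ (.inr (.inr (.inl rfl)))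
      have k₄ := k _ (.inr (.inr (.inr rfl)))
      simp only [pos] at k₁ k₂ k₃ k₄
      simp only [Fin.exists_fin_two]
      simp
      tauto
  · rintro ⟨h₀, h₁, h₂⟩ c ((hc | ⟨i, j, hij, hc⟩) | ⟨i, j, hij, hs, hc⟩)
    · exact h₀ c hc
    · have k₀ := h₁ i j hij 0 1 (by decide)
      have k₁ := h₁ i j hij 1 0 (by decide)
      rcases hc with rfl | rfl <;> simp only [neg, ← Bool.not_eq_true] <;> tauto
    · have k := h₂ i j hij hs
      simp only [Fin.exists_fin_two] at k
      simp at k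
      rcases hc with rfl | rfl | rfl | rfl <;> simp only [pos] <;> tauto

variable {b : Prop}

/-- A walk in a candidate graph is at least as long as the skeleton distance. For walks that start
at an extra vertex, the bound has to be stated for all its neighbours. -/
theorem candidate_walk_bound
    (h₁ : ∀ i k, (skeleton D 1).Adj i k → D i k ≤ 1)
    (h₂ : ∀ i k e, X (i, e) = true → X (k, e) = true → D i k ≤ 2)
    (h₃ : b → ∀ i k e e', e ≠ e' → X (i, e) = true → X (k, e') = true → D i k ≤ 3)
    (hq : 2 ≤ q) (hbq : b → 3 ≤ q) {u v : Fin n ⊕ Fin 2} (p : (candidate D X b).Walk u v)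
    (j : Fin n) (hv : v = .inl j) :
    (∀ i, u = .inl i → skeletonDist D q i j ≤ p.length) ∧
    ∀ e, u = .inr e →
      (∀ i, X (i, e) = true → skeletonDist D q i j ≤ p.length + 1) ∧
      (b → ∀ i e', e ≠ e' → X (i, e') = true → skeletonDist D q i j ≤ p.length + 2) := by
  induction p with
  | @nil u =>
    subst hv
    refine ⟨?_, by simp⟩
    rintro i h
    obtain rfl : j = i := by simpa using h
    simp [skeletonDist_self]
  | @cons u w v ha p ih =>
    obtain ⟨ih₁, ih₂⟩ := ih hv
    rw [Walk.length_cons, Nat.cast_add, Nat.cast_one]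
    constructor
    · rintro i rfl
      rcases w with k | e
      · have := skeletonDist_le_add (q := q) (j := j) (h₁ i k ha) (by omega)
        exact this.trans (by rw [Nat.cast_one, add_comm]; gcongr; exact ih₁ k rfl)
      · exact (ih₂ e rfl).1 i ha
    · rintro e rfl
      rcases w with k | e'
      · refine ⟨fun i hi => ?_, fun hb i e' he hi => ?_⟩
        · refine (skeletonDist_le_add (j := j) (h₂ i k e hi ha) hq).trans ?_
          rw [add_assoc, one_add_one_eq_two, Nat.cast_two, add_comm]
          gcongr
          exact ih₁ k rfl
        · refine (skeletonDist_le_add (j := j) (h₃ hb i k e' e he.symm hi ha) (hbq hb)).trans ?_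
          rw [add_assoc, add_comm]
          gcongr
          · exact ih₁ k rfl
          · norm_num
      · obtain ⟨he, hb⟩ : e ≠ e' ∧ b := ha
        refine ⟨fun i hi => ?_, fun _ i e'' he' hi => ?_⟩
        · rw [add_assoc, one_add_one_eq_two]
          exact (ih₂ e' rfl).2 hb i e he.symm hi
        · obtain rfl : e' = e'' := by omega
          refine ((ih₂ e' rfl).1 i hi).trans ?_
          rw [add_assoc]
          gcongr
          norm_num

theorem skeletonDist_le_edist
    (h₁ : ∀ i k, (skeleton D 1).Adj i k → D i k ≤ 1)
    (h₂ : ∀ i k e, X (i, e) = true → X (k, e) = true → D i k ≤ 2)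
    (h₃ : b → ∀ i k e e', e ≠ e' → X (i, e) = true → X (k, e') = true → D i k ≤ 3)
    (hq : 2 ≤ q) (hbq : b → 3 ≤ q) (i j : Fin n) :
    skeletonDist D q i j ≤ (candidate D X b).edist (.inl i) (.inl j) :=
  le_iInf fun p => (candidate_walk_bound h₁ h₂ h₃ hq hbq p j rfl).1 i rfl

theorem edist_le_skeletonDist {V : Type} {G : SimpleGraph V} {Φ : Fin n → V}
    (h : ∀ i k, (skeleton D q).Adj i k → G.edist (Φ i) (Φ k) ≤ D i k) (i j : Fin n) :
    G.edist (Φ i) (Φ j) ≤ skeletonDist D q i j := by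
  rw [skeletonDist_eq]
  refine le_iInf fun p => ?_
  induction p with
  | nil => simp
  | @cons i k j ha p ih =>
    rw [walkLength_cons, Nat.cast_add]
    exact SimpleGraph.edist_triangle.trans (add_le_add (h i k ha) ih)

theorem edist_le_two_of_satisfies (hD : IsDistanceMatrix D) (hX : Satisfies X (phi₂ D))
    {i k : Fin n} (h : (skeleton D 2).Adj i k) :
    (candidate D X b).edist (.inl i) (.inl k) ≤ D i k := by
  obtain ⟨hik, h⟩ := hD.adj_iff.1 h
  have h₀ := hD.pos i k hik
  obtain h | h : D i k = 1 ∨ D i k = 2 := by omega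
  · have ha : (candidate D X b).Adj (.inl i) (.inl k) := hD.adj_one_iff.2 h
    rw [h]
    exact Walk.edist_le ha.toWalk
  · have key : ∃ v, (candidate D X b).Adj (.inl i) v ∧ (candidate D X b).Adj v (.inl k) := by
      by_cases hs : 2 < (skeleton D 1).edist i k
      · obtain ⟨e, h₁, h₂⟩ := (satisfies_phi₂_iff.1 hX).2 i k h hs
        exact ⟨.inr e, h₁, h₂⟩
      · simp only [hD.two_lt_edist_iff h, not_forall, not_not] at hs
        obtain ⟨w, h₁, h₂⟩ := hs
        exact ⟨.inl w, hD.adj_one_iff.2 h₁, hD.adj_one_iff.2 h₂⟩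
    obtain ⟨v, h₁, h₂⟩ := key
    rw [h]
    exact Walk.edist_le (.cons h₁ h₂.toWalk)

theorem edist_candidate_phi₂ (hD : IsDistanceMatrix D) (hX : Satisfies X (phi₂ D)) (i j : Fin n) :
    (candidate D X False).edist (.inl i) (.inl j) = skeletonDist D 2 i j := by
  refine le_antisymm (edist_le_skeletonDist (fun i k => edist_le_two_of_satisfies hD hX) i j)
    (skeletonDist_le_edist (fun i k h => (hD.adj_one_iff.1 h).le) (fun i k e h₁ h₂ => ?_)
      (fun h => h.elim) le_rfl (fun h => h.elim) i j)
  by_contra h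
  exact (satisfies_phi₂_iff.1 hX).1 i k (not_le.1 h) e h₁ h₂

theorem edist_candidate_phi₂' (hD : IsDistanceMatrix D) (hX : Satisfies X (phi₂' D))
    (i j : Fin n) : (candidate D X True).edist (.inl i) (.inl j) = skeletonDist D 3 i j := by
  obtain ⟨hX₀, hX₁, hX₂⟩ := satisfies_phi₂'_iff.1 hX
  refine le_antisymm (edist_le_skeletonDist (fun i k h => ?_) i j)
    (skeletonDist_le_edist (fun i k h => (hD.adj_one_iff.1 h).le) (fun i k e h₁ h₂ => ?_)
      (fun _ i k e e' he h₁ h₂ => ?_) (by omega) (fun _ => le_rfl) i j)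
  · rw [hD.adj_iff] at h
    obtain h' | h' : D i k ≤ 2 ∨ D i k = 3 := by omega
    · exact edist_le_two_of_satisfies hD hX₀ (hD.adj_iff.2 ⟨h.1, h'⟩)
    · rw [h']
      by_cases hs : 3 < skeletonDist D 2 i k
      · obtain ⟨e, e', he, h₁, h₂⟩ := hX₂ i k h' hs
        have a₁ : (candidate D X True).Adj (.inl i) (.inr e) := h₁
        have a₂ : (candidate D X True).Adj (.inr e) (.inr e') := ⟨he, trivial⟩
        have a₃ : (candidate D X True).Adj (.inr e') (.inl k) := h₂
        exact Walk.edist_le (.cons a₁ (.cons a₂ a₃.toWalk))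
      · exact (edist_le_skeletonDist (fun i k => edist_le_two_of_satisfies hD hX₀) i k).trans
          (not_lt.1 hs)
  · by_contra h
    exact (satisfies_phi₂_iff.1 hX₀).1 i k (not_le.1 h) e h₁ h₂
  · by_contra h
    exact hX₁ i k (not_le.1 h) e e' he h₁ h₂

/-! ### Realisations with two extra vertices -/

theorem IsRealisation.isDistanceMatrix {V : Type} {G : SimpleGraph V} {Φ : Fin n → V}
    (h : IsRealisation D G Φ) : IsDistanceMatrix D where
  diag i := by
    have := h.2 i i
    rw [edist_self] at this
    exact_mod_cast this.symm
  pos i j hij := by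
    refine Nat.pos_of_ne_zero fun h₀ => hij (h.1 ?_)
    rw [← edist_eq_zero_iff (G := G), h.2, h₀, Nat.cast_zero]
  symm i j := by
    have := h.2 i j
    rw [edist_comm, h.2] at this
    exact_mod_cast this.symm
  triangle i j w := by
    have := SimpleGraph.edist_triangle (G := G) (u := Φ i) (v := Φ w) (w := Φ j)
    rw [h.2, h.2, h.2] at this
    exact_mod_cast this

open Classical in
/-- The assignment given by the adjacencies of the extra vertices. -/
noncomputable def assignmentOf (H : SimpleGraph (Fin n ⊕ Fin 2)) (x : EdgeVar n) : Bool :=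
  decide (H.Adj (.inl x.1) (.inr x.2))

theorem eq_candidate {H : SimpleGraph (Fin n ⊕ Fin 2)} (h : IsRealisation D H .inl) :
    H = candidate D (assignmentOf H) (H.Adj (.inr 0) (.inr 1)) := by
  have hadj : ∀ i j, H.Adj (.inl i) (.inl j) ↔ (skeleton D 1).Adj i j := by
    intro i j
    rw [h.isDistanceMatrix.adj_one_iff, ← edist_eq_one_iff_adj, h.2]
    exact_mod_cast Iff.rfl
  ext u v
  rcases u with i | e <;> rcases v with j | e'
  · exact hadj i j
  · simp [candidate, assignmentOf]
  · simp [candidate, assignmentOf, H.adj_comm]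
  · fin_cases e <;> fin_cases e' <;> simp [candidate, H.adj_comm]

theorem satisfies_phi₂_assignmentOf {H : SimpleGraph (Fin n ⊕ Fin 2)} (h : IsRealisation D H .inl) :
    Satisfies (assignmentOf H) (phi₂ D) := by
  have hD := h.isDistanceMatrix
  refine satisfies_phi₂_iff.2 ⟨fun i j hij e h₁ h₂ => ?_, fun i j hij hs => ?_⟩
  · simp only [assignmentOf, decide_eq_true_eq] at h₁ h₂
    have := Walk.edist_le (.cons h₁ h₂.symm.toWalk)
    rw [h.2] at this
    have : D i j ≤ 2 := by exact_mod_cast this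
    omega
  · have h₂ := h.2 i j
    rw [hij] at h₂
    obtain ⟨-, -, v, h₁, h₂⟩ := edist_eq_two_iff.1 h₂
    rcases v with k | e
    · rw [mem_neighborSet, ← edist_eq_one_iff_adj, h.2] at h₁ h₂
      refine absurd ⟨?_, ?_⟩ ((hD.two_lt_edist_iff hij).1 hs k)
      · exact_mod_cast h₁
      · rw [hD.symm]
        exact_mod_cast h₂
    · exact ⟨e, by simpa [assignmentOf] using h₁, by simpa [assignmentOf] using h₂⟩

theorem satisfies_phi₂'_assignmentOf {H : SimpleGraph (Fin n ⊕ Fin 2)}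
    (h : IsRealisation D H .inl) (hb : H.Adj (.inr 0) (.inr 1)) :
    Satisfies (assignmentOf H) (phi₂' D) := by
  have hD := h.isDistanceMatrix
  have hle : ∀ {i j} (p : H.Walk (.inl i) (.inl j)), D i j ≤ p.length := by
    intro i j p
    have := p.edist_le
    rw [h.2] at this
    exact_mod_cast this
  refine satisfies_phi₂'_iff.2 ⟨satisfies_phi₂_assignmentOf h, fun i j hij e e' he h₁ h₂ => ?_,
    fun i j hij hs => ?_⟩
  · simp only [assignmentOf, decide_eq_true_eq] at h₁ h₂
    have hee : H.Adj (.inr e) (.inr e') := by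
      fin_cases e <;> fin_cases e'
      · exact absurd rfl he
      · exact hb
      · exact hb.symm
      · exact absurd rfl he
    have := hle (.cons h₁ (.cons hee h₂.symm.toWalk))
    simp at this
    omega
  · obtain ⟨p, hp⟩ := exists_walk_of_edist_eq_coe ((h.2 i j).trans (by rw [hij]))
    -- a walk of length three with an inner vertex among the indices contradicts `hs`
    have hk : ∀ k, D i k + D k j ≤ 3 → D i k ≠ 0 → D k j ≠ 0 → False := by
      intro k h₁ h₂ h₃
      have h₄ := (hD.three_lt_skeletonDist_iff hij).1 hs k
      have h₅ := hD.triangle i j k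
      omega
    have hne : ∀ {x y : Fin n}, H.Adj (.inl x) (.inl y) → D x y ≠ 0 := by
      intro x y ha h₀
      obtain rfl := hD.eq_of_eq_zero h₀
      exact ha.ne rfl
    cases p with
    | nil => simp at hp
    | @cons _ u _ a₁ p =>
    cases p with
    | nil => simp at hp
    | @cons _ v _ a₂ p =>
    cases p with
    | nil => simp at hp
    | @cons _ w _ a₃ p =>
    cases p with
    | cons => simp at hp
    | nil =>
    rcases u with k | e
    · have k₁ := hle a₁.toWalk
      have k₂ := hle (.cons a₂ a₃.toWalk)
      have k₃ := hD.triangle i j k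
      simp at k₁ k₂
      exact (hk k (by omega) (hne a₁) (by omega)).elim
    · rcases v with k | e'
      · have k₁ := hle a₃.toWalk
        have k₂ := hle (.cons a₁ a₂.toWalk)
        have k₃ := hD.triangle i j k
        simp at k₁ k₂
        exact (hk k (by omega) (by omega) (hne a₃)).elim
      · refine ⟨e, e', ?_, by simpa [assignmentOf] using a₁, by simpa [assignmentOf] using a₃.symm⟩
        rintro rfl
        exact a₂.ne rfl

theorem edist_map {V W : Type} (G : SimpleGraph V) (ι : V ↪ W) (u v : V) :
    (G.map ι).edist (ι u) (ι v) = G.edist u v := by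
  refine le_antisymm (le_iInf fun p => ?_) (le_iInf fun p => ?_)
  · exact (Walk.edist_le (p.map (SimpleGraph.Embedding.map ι G).toHom)).trans
      (by rw [Walk.length_map])
  · suffices h : ∀ {x y} (p : (G.map ι).Walk x y) (u v : V), x = ι u → y = ι v →
        G.edist u v ≤ p.length from h p u v rfl rfl
    clear u v p
    intro x y p
    induction p with
    | nil =>
      rintro u v rfl h
      simp [ι.injective h]
    | @cons x w y ha p ih =>
      rintro u v rfl rfl
      obtain ⟨u', w', ha', hu, rfl⟩ := (map_adj ι G _ _).1 ha
      obtain rfl := ι.injective hu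
      have h₁ := ih w' v rfl rfl
      rw [Walk.length_cons, Nat.cast_add, add_comm]
      exact SimpleGraph.edist_triangle.trans (add_le_add (Walk.edist_le ha'.toWalk) h₁)

/-- A vertex set with at most two vertices outside the range of `Φ` embeds into `Fin n ⊕ Fin 2` such
that `Φ` becomes the inclusion. -/
theorem exists_embedding {V : Type} [Fintype V] {Φ : Fin n → V} (hΦ : Function.Injective Φ)
    (hV : Fintype.card V ≤ n + 2) : ∃ ι : V ↪ Fin n ⊕ Fin 2, ∀ i, ι (Φ i) = .inl i := by
  classical
  have hc : Fintype.card ↥(Set.range Φ)ᶜ ≤ Fintype.card (Fin 2) := by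
    rw [Fintype.card_compl_set, Set.card_range_of_injective hΦ, Fintype.card_fin, Fintype.card_fin]
    omega
  obtain ⟨f⟩ := Function.Embedding.nonempty_of_card_le hc
  let e := (Equiv.Set.sumCompl (Set.range Φ)).symm.trans
    (Equiv.sumCongr (Equiv.ofInjective Φ hΦ).symm (Equiv.refl _))
  refine ⟨e.toEmbedding.trans ((Function.Embedding.refl _).sumMap f), fun i => ?_⟩
  have : e (Φ i) = .inl i := by
    rw [← Equiv.eq_symm_apply]
    simp [e]
  simp [this]

/-- A realisation with at most two extra vertices can be completed, by isolated vertices, to one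
with exactly two extra vertices. -/
theorem IsRealisation.map {V : Type} {G : SimpleGraph V} {Φ : Fin n → V} (h : IsRealisation D G Φ)
    {ι : V ↪ Fin n ⊕ Fin 2} (hι : ∀ i, ι (Φ i) = .inl i) : IsRealisation D (G.map ι) .inl :=
  ⟨Sum.inl_injective, fun i j => by rw [← hι, ← hι, edist_map, h.2]⟩

theorem IsRealisation.exists_of_notMem {V : Type} [Fintype V] {G : SimpleGraph V} {Φ : Fin n → V}
    (h : IsRealisation D G Φ) (hV : Fintype.card V = n + 2) {a b : V} (ha : a ∉ Set.range Φ)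
    (hb : b ∉ Set.range Φ) (hab : a ≠ b) :
    ∃ H : SimpleGraph (Fin n ⊕ Fin 2), IsRealisation D H .inl ∧
      (H.Adj (.inr 0) (.inr 1) ↔ G.Adj a b) := by
  obtain ⟨ι, hι⟩ := exists_embedding h.1 hV.le
  refine ⟨G.map ι, h.map hι, ?_⟩
  have hr : ∀ x, x ∉ Set.range Φ → ∃ e, ι x = .inr e := by
    intro x hx
    rcases hx' : ι x with i | e
    · exact absurd ⟨i, ι.injective ((hι i).trans hx'.symm)⟩ hx
    · exact ⟨e, rfl⟩
  obtain ⟨e, he⟩ := hr a ha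
  obtain ⟨e', he'⟩ := hr b hb
  have hne : e ≠ e' := by
    rintro rfl
    exact hab (ι.injective (he.trans he'.symm))
  rw [← map_adj_apply (f := ι) (G := G), he, he']
  fin_cases e <;> fin_cases e'
  · exact absurd rfl hne
  · exact Iff.rfl
  · exact adj_comm ..
  · exact absurd rfl hne

end CombDMR

/-! ### Reading the input -/

namespace CombDMR

open Computability StackProg

theorem foldl_carry_false (l acc : List Bool) :
    l.foldl (fun (s : List Bool × Bool) b => (Bool.xor b s.2 :: s.1, b && s.2)) (acc, false) =
      (l.reverse ++ acc, false) := by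
  induction l generalizing acc with
  | nil => rfl
  | cons b l ih => simp [ih]

/-- The invariant of `binSucc` as long as there is a carry. -/
theorem foldl_carry_true (p : PosNum) (acc : List Bool) :
    let s := (encodePosNum p).foldl
      (fun (s : List Bool × Bool) b => (Bool.xor b s.2 :: s.1, b && s.2)) (acc, true)
    (bif s.2 then true :: s.1 else s.1) = (encodePosNum p.succ).reverse ++ acc := by
  induction p generalizing acc with
  | one => rfl
  | bit1 p ih => simpa [encodePosNum, PosNum.succ] using ih (false :: acc)
  | bit0 p _ => simp [encodePosNum, PosNum.succ, foldl_carry_false]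

theorem binSucc_encodeNat (m : ℕ) : binSucc (encodeNat m) = encodeNat (m + 1) := by
  have h : ((m + 1 : ℕ) : Num) = (m : Num).succ := by
    rw [Nat.cast_succ, Num.add_one]
  rw [encodeNat, encodeNat, h]
  rcases (m : Num) with _ | p
  · rfl
  · have := foldl_carry_true p []
    rw [List.append_nil] at this
    exact (congrArg List.reverse this).trans (List.reverse_reverse _)

theorem binSucc_iterate_encodeNat (c m : ℕ) : binSucc^[c] (encodeNat m) = encodeNat (m + c) := by
  induction c with
  | zero => rfl
  | succ c ih => rw [Function.iterate_succ_apply', ih, binSucc_encodeNat, Nat.add_assoc]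

theorem encodeNat_injective : Function.Injective encodeNat :=
  Function.LeftInverse.injective decode_encodeNat

theorem near_encodeNat {c x y : ℕ} :
    near c (encodeNat x) (encodeNat y) = true ↔ x ≤ y + c ∧ y ≤ x + c := by
  induction c with
  | zero =>
    simp only [near, encodeNat_injective.eq_iff, decide_eq_true_eq]
    omega
  | succ c ih =>
    simp only [near, binSucc_iterate_encodeNat, encodeNat_injective.eq_iff, Bool.or_eq_true, ih,
      decide_eq_true_eq]
    omega

variable {n : ℕ} {D : Matrix (Fin n) (Fin n) ℕ}

/-- The table of the binary numerals of the entries of `D`. -/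
def table (D : Matrix (Fin n) (Fin n) ℕ) : Table :=
  (List.finRange n).map fun i => (List.finRange n).map fun j => encodeNat (D i j)

theorem foldr_readStep_digits (l : List Bool) (s : List (List Bool) × Table) :
    (l.map Γ'.bit).foldr (fun x s => readStep s x) ([], s) = (l, s) := by
  induction l with
  | nil => rfl
  | cons b l ih =>
    rw [List.map_cons, List.foldr_cons, ih]
    cases b <;> rfl

theorem foldr_readStep_row {ι : Type} (f : ι → ℕ) (L : List ι) (T : Table) :
    (L.flatMap fun j => Γ'.comma :: (encodeNat (f j)).map Γ'.bit).foldr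
      (fun x s => readStep s x) ([], [], T) = ([], L.map fun j => encodeNat (f j), T) := by
  induction L with
  | nil => rfl
  | cons j L ih =>
    rw [List.flatMap_cons, List.foldr_append, ih, List.foldr_cons, foldr_readStep_digits]
    rfl

theorem foldr_readStep_rows {ι : Type} (f : ι → ι → ℕ) (K L : List ι) :
    (L.flatMap fun i => Γ'.bra :: ((K.flatMap fun j =>
      Γ'.comma :: (encodeNat (f i j)).map Γ'.bit) ++ [Γ'.ket])).foldr
        (fun x s => readStep s x) ([], [], []) =
      ([], [], L.map fun i => K.map fun j => encodeNat (f i j)) := by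
  induction L with
  | nil => rfl
  | cons i L ih =>
    rw [List.flatMap_cons, List.foldr_append, ih, List.foldr_cons, List.foldr_append]
    exact congrArg (readStep · .bra) (foldr_readStep_row (f i) K _)

theorem readTable_encodeInstance (D : Matrix (Fin n) (Fin n) ℕ) :
    readTable (encodeInstance ⟨n, D⟩).reverse = table D := by
  rw [readTable, List.foldl_reverse]
  exact congrArg (·.2.2) (foldr_readStep_rows D (List.finRange n) (List.finRange n))

@[simp] theorem entry_table (i j : Fin n) : entry (table D) i j = encodeNat (D i j) := by
  simp [entry, table, List.getD_eq_getElem?_getD]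

@[simp] theorem isNum_table {c : ℕ} {i j : Fin n} : isNum (table D) c i j = true ↔ D i j = c := by
  simp [isNum, encodeNat_injective.eq_iff]

@[simp] theorem isSmall_table {q : ℕ} {i j : Fin n} :
    isSmall (table D) q i j = true ↔ D i j ≤ q := by
  simp [isSmall, encodeNat_injective.eq_iff]

@[simp] theorem between_table {c : ℕ} {i w j : Fin n} :
    between (table D) c i w j = true ↔ D i w = c ∧ D i j = D w j + c := by
  simp [between, encodeNat_injective.eq_iff, binSucc_iterate_encodeNat]

@[simp] theorem all_range_table {p : ℕ → Bool} :
    ((List.range (table D).length).all p) = true ↔ ∀ i : Fin n, p i = true := by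
  simp [table, Fin.forall_iff]

@[simp] theorem any_range_table {p : ℕ → Bool} :
    ((List.range (table D).length).any p) = true ↔ ∃ i : Fin n, p i = true := by
  simp [table, Fin.exists_iff]

@[simp] theorem triangles_table {c : ℕ} : triangles (table D) c = true ↔
    ∀ i w, D i w = c → ∀ j, D i j ≤ D w j + c ∧ D w j ≤ D i j + c := by
  simp only [triangles, all_range_table, Bool.or_eq_true, Bool.not_eq_true', ← Bool.not_eq_true,
    isNum_table, entry_table, near_encodeNat, imp_iff_not_or]

/-! ### Correctness of the algorithm -/

theorem isSkeletal_table {b : Bool} :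
    isSkeletal b (table D) = true ↔ IsSkeletalMatrix D (bif b then 3 else 2) := by
  have key : isSkeletal b (table D) = true ↔
      (∀ i j, (D i j = 0 ↔ i = j) ∧ D i j = D j i) ∧
      (∀ c, 1 ≤ c → c ≤ (bif b then 3 else 2) → ∀ i w, D i w = c → ∀ j,
        D i j ≤ D w j + c ∧ D w j ≤ D i j + c) ∧
      ∀ i j, D i j ≤ (bif b then 3 else 2) ∨
        ∃ w, 1 ≤ D i w ∧ D i w ≤ (bif b then 3 else 2) ∧ D i j = D w j + D i w := by
    have h₀ : ∀ i j : Fin n,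
        isNum (table D) 0 i j = decide ((i : ℕ) = j) ↔ (D i j = 0 ↔ i = j) := by
      intro i j
      rw [Bool.eq_iff_iff, isNum_table, decide_eq_true_eq, Fin.ext_iff]
    cases b
    · simp only [isSkeletal, all_range_table, any_range_table, Bool.and_eq_true, Bool.or_eq_true,
        decide_eq_true_eq, h₀, entry_table, encodeNat_injective.eq_iff, triangles_table, cond_false,
        isSmall_table, between_table, Bool.not_false, Bool.false_eq_true, false_and, or_false,
        true_or, and_true]
      refine and_congr_right' (and_congr ?_ ?_)
      · refine ⟨fun h c hc hc' => ?_, fun h => ⟨h 1 (by simp) (by simp), h 2 (by simp) (by simp)⟩⟩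
        interval_cases c
        exacts [h.1, h.2]
      · refine forall₂_congr fun i j => or_congr_right (exists_congr fun w => ?_)
        omega
    · simp only [isSkeletal, all_range_table, any_range_table, Bool.and_eq_true, Bool.or_eq_true,
        decide_eq_true_eq, h₀, entry_table, encodeNat_injective.eq_iff, triangles_table, cond_true,
        isSmall_table, between_table, Bool.not_true, Bool.false_eq_true, true_and, false_or,
        and_assoc]
      refine and_congr_right' ?_
      rw [← and_assoc, ← and_assoc]
      refine and_congr ?_ ?_
      · refine ⟨fun h c hc hc' => ?_, fun h => ⟨⟨h 1 (by simp) (by simp), h 2 (by simp) (by simp)⟩,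
          h 3 (by simp) (by simp)⟩⟩
        interval_cases c
        exacts [h.1.1, h.1.2, h.2]
      · refine forall₂_congr fun i j => or_congr_right (exists_congr fun w => ?_)
        omega
  rw [key]
  constructor
  · rintro ⟨h₁, h₂, h₃⟩
    refine ⟨fun i j => (h₁ i j).1, fun i j => (h₁ i j).2,
      fun i w j h h' => (h₂ _ h h' i w rfl j).1, fun i j h => ?_⟩
    exact (h₃ i j).resolve_left (by omega)
  · refine fun h => ⟨fun i j => ⟨h.eq_zero_iff i j, h.symm i j⟩, ?_, fun i j => ?_⟩
    · rintro _ hc hc' i w rfl j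
      exact ⟨h.triangle i w j hc hc', by
        have := h.triangle w i j (h.symm i w ▸ hc) (h.symm i w ▸ hc')
        rwa [h.symm w i] at this⟩
    · by_cases hij : D i j ≤ (bif b then 3 else 2)
      · exact .inl hij
      · exact .inr (h.exists_between i j (by omega))

/-- The formula for graphs in which the extra vertices are adjacent iff `b`. -/
def formula (b : Bool) (D : Matrix (Fin n) (Fin n) ℕ) : TwoCNF (EdgeVar n) :=
  bif b then phi₂' D else phi₂ D

theorem lacksTwo_table (hD : IsDistanceMatrix D) {i j : Fin n} :
    lacksTwo (table D) i j = true ↔ D i j = 2 ∧ 2 < (skeleton D 1).edist i j := by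
  rw [lacksTwo, Bool.and_eq_true, isNum_table]
  refine and_congr_right fun h => ?_
  rw [hD.two_lt_edist_iff h, Bool.not_eq_true', Bool.eq_false_iff, Ne, any_range_table]
  simp

theorem lacksThree_table (hD : IsDistanceMatrix D) {i j : Fin n} :
    lacksThree (table D) i j = true ↔ D i j = 3 ∧ 3 < skeletonDist D 2 i j := by
  rw [lacksThree, Bool.and_eq_true, isNum_table]
  refine and_congr_right fun h => ?_
  rw [hD.three_lt_skeletonDist_iff h, Bool.not_eq_true', Bool.eq_false_iff, Ne, any_range_table]
  simp

theorem isClause_table (hD : IsDistanceMatrix D) {b e f s t : Bool} {i j : Fin n} :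
    isClause b (table D) (((i : ℕ), e), s) (((j : ℕ), f), t) = true ↔
      (s = false ∧ t = false ∧ (e = f ∧ 2 < D i j ∨ e ≠ f ∧ b = true ∧ 3 < D i j)) ∨
      (s = true ∧ t = true ∧ (e = f ∧ b = true ∧ D i j = 3 ∧ 3 < skeletonDist D 2 i j ∨
        e ≠ f ∧ ((D i j = 2 ∧ 2 < (skeleton D 1).edist i j) ∨ i = j ∧ ∃ k,
          (D i k = 2 ∧ 2 < (skeleton D 1).edist i k ∨
            b = true ∧ D i k = 3 ∧ 3 < skeletonDist D 2 i k)))) := by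
  have h₂ : isSmall (table D) 2 i j = false ↔ 2 < D i j := by
    rw [← Bool.not_eq_true, isSmall_table, not_le]
  have h₃ : isSmall (table D) 3 i j = false ↔ 3 < D i j := by
    rw [← Bool.not_eq_true, isSmall_table, not_le]
  by_cases hef : e = f <;>
  simp [-List.any_eq_true, isClause, hef, h₂, h₃, lacksTwo_table hD, lacksThree_table hD,
    ← Fin.ext_iff, and_assoc]

/-- The formula in terms of an assignment to the variables of the algorithm, where the second extra
vertex is represented by `true`. -/
theorem satisfies_formula_iff {b : Bool} {Y : ℕ × Bool → Bool} :
    Satisfies (fun v : EdgeVar n => Y (v.1, decide (v.2 = 1))) (formula b D) ↔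
      ((∀ i j, 2 < D i j → ∀ e, Y (i, e) = true → Y (j, e) = true → False) ∧
      ∀ i j, D i j = 2 → 2 < (skeleton D 1).edist i j →
        ∃ e, Y (i, e) = true ∧ Y (j, e) = true) ∧
      (b = true → (∀ i j, 3 < D i j → ∀ e, Y (i, e) = true → Y (j, !e) = true → False) ∧
      ∀ i j, D i j = 3 → 3 < skeletonDist D 2 i j →
        ∃ e, Y (i, e) = true ∧ Y (j, !e) = true) := by
  cases b <;>
  simp [formula, satisfies_phi₂'_iff, satisfies_phi₂_iff, Fin.forall_fin_two, Fin.exists_fin_two]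

/-- The literals of the algorithm are `((i, e), s)` with `e = true` for the second extra vertex. -/
theorem satisfies_formula_iff_isClause (hD : IsDistanceMatrix D) {b : Bool} {Y : ℕ × Bool → Bool} :
    Satisfies (fun v : EdgeVar n => Y (v.1, decide (v.2 = 1))) (formula b D) ↔
      ∀ x ∈ TwoSat.lits (vars (table D)), ∀ y ∈ TwoSat.lits (vars (table D)),
        isClause b (table D) x y = true → Y x.1 = x.2 ∨ Y y.1 = y.2 := by
  have hlits : ∀ {p : (ℕ × Bool) × Bool → Prop}, (∀ x ∈ TwoSat.lits (vars (table D)), p x) ↔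
      ∀ (i : Fin n) (e s : Bool), p ((i, e), s) := by
    intro p
    constructor
    · intro h i e s
      refine h _ (TwoSat.mem_lits.2 ?_)
      cases e <;> simp [vars, table]
    · rintro h ⟨⟨i, e⟩, s⟩ hx
      have hi : i < n := by
        have := TwoSat.mem_lits.1 hx
        simp only [vars, table, List.mem_flatMap, List.mem_range] at this
        obtain ⟨k, hk, h⟩ := this
        simp at hk h
        omega
      exact h ⟨i, hi⟩ e s
  rw [satisfies_formula_iff]
  simp only [hlits]
  constructor
  · rintro ⟨⟨h₁, h₂⟩, h₃⟩ i e s j f t hc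
    rcases (isClause_table hD).1 hc with ⟨rfl, rfl, ⟨rfl, h⟩ | ⟨hef, hb, h⟩⟩ |
      ⟨rfl, rfl, ⟨rfl, hb, h, h'⟩ | ⟨hef, ⟨h, h'⟩ | ⟨rfl, k, ⟨h, h'⟩ | ⟨hb, h, h'⟩⟩⟩⟩
    · have := h₁ i j h e
      simp only [Bool.eq_false_iff]
      tauto
    · have := (h₃ hb).1 i j h e
      obtain rfl : f = !e := Bool.eq_not_of_ne hef.symm
      simp only [Bool.eq_false_iff]
      tauto
    · obtain ⟨g, hg⟩ := (h₃ hb).2 i j h h'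
      cases e <;> cases g <;> simp_all only [Bool.not_true, Bool.not_false, or_true, true_or]
    · obtain ⟨g, hg⟩ := h₂ i j h h'
      cases e <;> cases f <;> cases g <;>
        simp_all only [or_true, true_or]
    · obtain ⟨g, hg⟩ := h₂ i k h h'
      cases e <;> cases f <;> cases g <;>
        simp_all only [or_true, true_or]
    · obtain ⟨g, hg⟩ := (h₃ hb).2 i k h h'
      cases e <;> cases f <;> cases g <;>
        simp_all only [or_true, true_or]
  · intro h
    have symm₂ : ∀ i j, (D i j = 2 ∧ 2 < (skeleton D 1).edist i j) →
        (D j i = 2 ∧ 2 < (skeleton D 1).edist j i) := by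
      intro i j h
      rwa [hD.symm j i, SimpleGraph.edist_comm]
    have symm₃ : ∀ i j, (D i j = 3 ∧ 3 < skeletonDist D 2 i j) →
        (D j i = 3 ∧ 3 < skeletonDist D 2 j i) := by
      refine fun i j h => ⟨hD.symm i j ▸ h.1,
        (hD.three_lt_skeletonDist_iff (hD.symm i j ▸ h.1)).2 ?_⟩
      have := (hD.three_lt_skeletonDist_iff h.1).1 h.2
      intro w hw
      refine this w ?_
      rw [hD.symm i w, hD.symm w j]
      tauto
    have h' := fun i e s j f t hc => h i e s j f t ((isClause_table hD).2 hc)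
    refine ⟨⟨fun i j hij e => ?_, fun i j h₁ h₂ => ?_⟩,
      fun hb => ⟨fun i j hij e => ?_, fun i j h₁ h₂ => ?_⟩⟩
    · have := h' i e false j e false (by simp [hij])
      simp only [Bool.eq_false_iff] at this
      tauto
    · have c₁ := h' i false true j true true (by simp [h₁, h₂])
      have c₂ := h' i true true j false true (by simp [h₁, h₂])
      have c₃ := h' i false true i true true
        (.inr ⟨rfl, rfl, .inr ⟨by simp, .inr ⟨rfl, j, .inl ⟨h₁, h₂⟩⟩⟩⟩)
      have c₄ := h' j false true j true true
        (.inr ⟨rfl, rfl, .inr ⟨by simp, .inr ⟨rfl, i, .inl (symm₂ i j ⟨h₁, h₂⟩)⟩⟩⟩)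
      rw [Bool.exists_bool]
      tauto
    · have := h' i e false j (!e) false (by simp [hij, hb])
      simp only [Bool.eq_false_iff] at this
      tauto
    · have c₁ := h' i false true j false true (by simp [hb, h₁, h₂])
      have c₂ := h' i true true j true true (by simp [hb, h₁, h₂])
      have c₃ := h' i false true i true true
        (.inr ⟨rfl, rfl, .inr ⟨by simp, .inr ⟨rfl, j, .inr ⟨hb, h₁, h₂⟩⟩⟩⟩)
      have c₄ := h' j false true j true true
        (.inr ⟨rfl, rfl, .inr ⟨by simp, .inr ⟨rfl, i, .inr ⟨hb, symm₃ i j ⟨h₁, h₂⟩⟩⟩⟩⟩)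
      rw [Bool.exists_bool]
      tauto

end CombDMR

namespace CombDMR

open Computability StackProg

variable {n : ℕ} {D : Matrix (Fin n) (Fin n) ℕ}

/-- The assignment found by the algorithm. -/
def assignment (b : Bool) (D : Matrix (Fin n) (Fin n) ℕ) (v : EdgeVar n) : Bool :=
  TwoSat.value (trueLits b (table D)) ((v.1, decide (v.2 = 1)), true)

/-- The graph found by the algorithm, if it succeeds. -/
def graph (b : Bool) (D : Matrix (Fin n) (Fin n) ℕ) : SimpleGraph (Fin n ⊕ Fin 2) :=
  candidate D (assignment b D) (b = true)

theorem isRealisation_candidate {b : Bool} {X : EdgeVar n → Bool} (hD : IsDistanceMatrix D)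
    (hX : Satisfies X (formula b D))
    (h : ∀ i j, skeletonDist D (bif b then 3 else 2) i j = (D i j : ℕ∞)) :
    IsRealisation D (candidate D X (b = true)) .inl := by
  refine ⟨Sum.inl_injective, fun i j => ?_⟩
  rw [← h]
  cases b
  · simpa using edist_candidate_phi₂ hD hX i j
  · simpa using edist_candidate_phi₂' hD hX i j

theorem satisfies_assignmentOf {b : Bool} {H : SimpleGraph (Fin n ⊕ Fin 2)}
    (h : IsRealisation D H .inl) (hb : H.Adj (.inr 0) (.inr 1) ↔ b = true) :
    Satisfies (assignmentOf H) (formula b D) := by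
  cases b
  · exact satisfies_phi₂_assignmentOf h
  · exact satisfies_phi₂'_assignmentOf h (hb.2 rfl)

/-- A realisation on the `n + 2` vertices exists iff the formula is satisfiable and `D` is the
distance matrix of its skeleton. -/
theorem exists_isRealisation_iff {b : Bool} (hD : IsDistanceMatrix D) :
    (∃ H : SimpleGraph (Fin n ⊕ Fin 2), IsRealisation D H .inl ∧
      (H.Adj (.inr 0) (.inr 1) ↔ b = true)) ↔
    (∃ X, Satisfies X (formula b D)) ∧
      ∀ i j, skeletonDist D (bif b then 3 else 2) i j = (D i j : ℕ∞) := by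
  constructor
  · rintro ⟨H, h, hb⟩
    have hX := satisfies_assignmentOf h hb
    refine ⟨⟨_, hX⟩, fun i j => ?_⟩
    rw [← h.2, eq_candidate h, hb]
    cases b
    · simpa using (edist_candidate_phi₂ hD hX i j).symm
    · simpa using (edist_candidate_phi₂' hD hX i j).symm
  · rintro ⟨⟨X, hX⟩, h⟩
    exact ⟨_, isRealisation_candidate hD hX h, by simp [candidate]⟩

theorem satisfies_assignment {b : Bool} (h : succeeds b (table D) = true) :
    Satisfies (assignment b D) (formula b D) := by
  obtain ⟨h₁, h₂⟩ := Bool.and_eq_true_iff.1 h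
  refine (satisfies_formula_iff_isClause (isSkeletal_table.1 h₁).isDistanceMatrix
    (Y := fun v => TwoSat.value (trueLits b (table D)) (v, true))).2 fun x hx y hy hc => ?_
  have := List.all_eq_true.1 h₂ (x, y) (TwoSat.mem_pairs.2 ⟨hx, hy⟩)
  simpa [hc, TwoSat.value_eq_true_iff (a := x), TwoSat.value_eq_true_iff (a := y), trueLits]
    using this

theorem isRealisation_graph {b : Bool} (h : succeeds b (table D) = true) :
    IsRealisation D (graph b D) .inl := by
  have hD := isSkeletalMatrix_iff.1 (isSkeletal_table.1 (Bool.and_eq_true_iff.1 h).1)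
  exact isRealisation_candidate hD.1 (satisfies_assignment h) hD.2

theorem succeeds_iff {b : Bool} : succeeds b (table D) = true ↔
    ∃ H : SimpleGraph (Fin n ⊕ Fin 2), IsRealisation D H .inl ∧
      (H.Adj (.inr 0) (.inr 1) ↔ b = true) := by
  refine ⟨fun h => ⟨_, isRealisation_graph h, by simp [graph, candidate]⟩, fun ⟨H, h, hb⟩ => ?_⟩
  have hD := h.isDistanceMatrix
  refine Bool.and_eq_true_iff.2 ⟨isSkeletal_table.2 (isSkeletalMatrix_iff.2
    ⟨hD, ((exists_isRealisation_iff hD).1 ⟨H, h, hb⟩).2⟩), ?_⟩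
  let Y : ℕ × Bool → Bool := fun v => if h : v.1 < n then
    assignmentOf H (⟨v.1, h⟩, bif v.2 then 1 else 0) else false
  refine TwoSat.solved_of_satisfiable (Y := Y) ((satisfies_formula_iff_isClause hD).1 ?_)
  convert satisfies_assignmentOf h hb using 2 with v
  obtain ⟨i, e⟩ := v
  fin_cases e <;> simp [Y]

theorem isYesInstance_iff : IsYesInstance 2 D ↔
    succeeds false (table D) = true ∨ succeeds true (table D) = true := by
  constructor
  · rintro ⟨V, _, G, Φ, hV, h⟩
    obtain ⟨ι, hι⟩ := exists_embedding h.1 hV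
    rw [succeeds_iff, succeeds_iff]
    by_cases hb : (G.map ι).Adj (.inr 0) (.inr 1)
    · exact .inr ⟨_, h.map hι, by simp [hb]⟩
    · exact .inl ⟨_, h.map hι, by simp [hb]⟩
  · intro h
    have : ∃ b, succeeds b (table D) = true := by
      rcases h with h | h
      exacts [⟨_, h⟩, ⟨_, h⟩]
    obtain ⟨b, h⟩ := this
    exact ⟨_, inferInstance, _, _, by simp, isRealisation_graph h⟩

/-! ### The machines -/

/-- The function computed by the construction algorithm. -/
def construct (I : Instance) : Output :=
  if succeeds false (table I.2) then some ⟨I.1, graph false I.2⟩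
  else if succeeds true (table I.2) then some ⟨I.1, graph true I.2⟩ else none

/-- The function computed by the decision algorithm. -/
def decideYes (I : Instance) : Bool := succeeds false (table I.2) || succeeds true (table I.2)

/-- The representation of the vertices in the algorithm. -/
def vertexCode : Fin n ⊕ Fin 2 → Bool × ℕ × Bool
  | .inl i => (false, i, false)
  | .inr e => (true, 0, decide (e = 1))

theorem verts_table : verts (table D) = (vertexList n).map vertexCode := by
  simp [verts, vertexList, vertexCode, table, ← List.map_coe_finRange_eq_range]

theorem isAdj_table (hD : IsDistanceMatrix D) (b : Bool) (u v : Fin n ⊕ Fin 2) :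
    isAdj b (table D) (trueLits b (table D)) (vertexCode u) (vertexCode v) = true ↔
      (graph b D).Adj u v := by
  rcases u with i | e <;> rcases v with j | f
  · simp [isAdj, vertexCode, graph, candidate, hD.adj_one_iff]
  · simp only [isAdj, vertexCode, graph, candidate, assignment, TwoSat.value, cond_false, cond_true,
      decide_eq_true_eq]
    exact decide_eq_true_iff
  · simp only [isAdj, vertexCode, graph, candidate, assignment, TwoSat.value, cond_false, cond_true,
      decide_eq_true_eq]
    exact decide_eq_true_iff
  · fin_cases e <;> fin_cases f <;> simp [isAdj, vertexCode, graph, candidate]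

theorem map_graphWord (hD : IsDistanceMatrix D) (b : Bool) :
    (graphWord b (table D)).map (fun k => [Γ'.bit false, Γ'.bit true, Γ'.bra, Γ'.ket][k]?) =
      (encodeOutput (some ⟨n, graph b D⟩)).map some := by
  classical
  simp only [graphWord, encodeOutput, verts_table, List.map_cons, List.map_flatMap,
    List.flatMap_map, List.map_append, List.map_map, List.map_nil]
  refine congrArg₂ _ rfl (congrArg₂ _ (funext fun u => congrArg₂ _ rfl (congrArg₂ _
    (List.map_congr_left fun v _ => ?_) rfl)) rfl)
  by_cases h : (graph b D).Adj u v
  · simp [(isAdj_table hD b u v).2 h, h]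
  · simp [Bool.eq_false_iff.2 (mt (isAdj_table hD b u v).1 h), h]

theorem map_constructWord (I : Instance) :
    (constructWord (encodeInstance I).reverse).map
      (fun k => [Γ'.bit false, Γ'.bit true, Γ'.bra, Γ'.ket][k]?) =
      (encodeOutput (construct I)).reverse.map some := by
  obtain ⟨n, D⟩ := I
  have hD : ∀ b, succeeds b (table D) = true → IsDistanceMatrix D :=
    fun b h => (isRealisation_graph h).isDistanceMatrix
  rw [constructWord, readTable_encodeInstance, List.map_reverse, List.map_reverse, construct]
  congr 1
  by_cases h₀ : succeeds false (table D) = true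
  · simpa [h₀] using map_graphWord (hD _ h₀) false
  · by_cases h₁ : succeeds true (table D) = true
    · simpa [h₀, h₁] using map_graphWord (hD _ h₁) true
    · simp [h₀, h₁, encodeOutput]

theorem map_decideWord (I : Instance) :
    (decideWord (encodeInstance I).reverse).map (fun k => [false, true][k]?) =
      (encodeBool (decideYes I)).reverse.map some := by
  obtain ⟨n, D⟩ := I
  rw [decideWord, readTable_encodeInstance, decideYes]
  cases succeeds false (table D) || succeeds true (table D) <;> rfl

theorem exists_machines :
    ∃ (A : Turing.TM2ComputableInPolyTime encodeInstance encodeBool decideYes)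
      (B : Turing.TM2ComputableInPolyTime encodeInstance encodeOutput construct),
      A.time = B.time := by
  obtain ⟨P, hP⟩ := pt_decideWord.exists_machine _ map_decideWord
  obtain ⟨Q, hQ⟩ := pt_constructWord.exists_machine _ map_constructWord
  obtain ⟨A, hA⟩ := hP Q
  obtain ⟨B, hB⟩ := hQ P
  exact ⟨A, B, by rw [hA, hB, add_comm]⟩

theorem construct_of_isYesInstance (h : IsYesInstance 2 D) :
    ∃ G : SimpleGraph (Fin n ⊕ Fin 2), construct ⟨n, D⟩ = some ⟨n, G⟩ ∧ IsRealisation D G .inl ∧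
      ((∃ X, Satisfies X (phi₂ D) ∧ G = candidate D X False) ∨
        (∃ X, Satisfies X (phi₂' D) ∧ G = candidate D X True)) := by
  by_cases h₀ : succeeds false (table D) = true
  · refine ⟨graph false D, by simp [construct, h₀], isRealisation_graph h₀,
      .inl ⟨_, satisfies_assignment h₀, ?_⟩⟩
    simp [graph]
  · have h₁ := (isYesInstance_iff.1 h).resolve_left h₀
    refine ⟨graph true D, by simp [construct, h₀, h₁], isRealisation_graph h₁,
      .inr ⟨_, satisfies_assignment h₁, ?_⟩⟩
    simp [graph]

theorem construct_of_not_isYesInstance (h : ¬ IsYesInstance 2 D) : construct ⟨n, D⟩ = none := by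
  rw [isYesInstance_iff, not_or] at h
  simp [construct, h.1, h.2]

/-- A realisation with `n + 2` vertices may be assumed to have the vertices `Fin n ⊕ Fin 2`. -/
theorem exists_card_eq_iff {p : Prop → Prop} :
    (∃ (V : Type) (_ : Fintype V) (G : SimpleGraph V) (Φ : Fin n → V) (a b : V),
      Fintype.card V = n + 2 ∧ IsRealisation D G Φ ∧ a ∉ Set.range Φ ∧ b ∉ Set.range Φ ∧ a ≠ b ∧
        p (G.Adj a b)) ↔
    ∃ H : SimpleGraph (Fin n ⊕ Fin 2), IsRealisation D H .inl ∧ p (H.Adj (.inr 0) (.inr 1)) := by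
  constructor
  · rintro ⟨V, _, G, Φ, a, b, hV, h, ha, hb, hab, hp⟩
    obtain ⟨H, hH, hadj⟩ := h.exists_of_notMem hV ha hb hab
    exact ⟨H, hH, by rwa [hadj]⟩
  · rintro ⟨H, h, hp⟩
    exact ⟨_, inferInstance, H, .inl, .inr 0, .inr 1, by simp, h, by simp, by simp, by simp, hp⟩

end CombDMR

theorem theorem3 :
    -- a decision algorithm and a construction algorithm with the same polynomial time bound
    (∃ (decideYes : CombDMR.Instance → Bool) (construct : CombDMR.Instance → CombDMR.Output)
      (A : Turing.TM2ComputableInPolyTime CombDMR.encodeInstance Computability.encodeBool decideYes)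
      (B : Turing.TM2ComputableInPolyTime CombDMR.encodeInstance CombDMR.encodeOutput construct),
      A.time = B.time ∧
      ∀ (n : ℕ) (D : Matrix (Fin n) (Fin n) ℕ),
        (decideYes ⟨n, D⟩ = true ↔ CombDMR.IsYesInstance 2 D) ∧
        (CombDMR.IsYesInstance 2 D → ∃ G : SimpleGraph (Fin n ⊕ Fin 2),
          construct ⟨n, D⟩ = some ⟨n, G⟩ ∧ CombDMR.IsRealisation D G Sum.inl ∧
          ((∃ X, CombDMR.Satisfies X (CombDMR.phi₂ D) ∧ G = CombDMR.candidate D X False) ∨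
            (∃ X, CombDMR.Satisfies X (CombDMR.phi₂' D) ∧ G = CombDMR.candidate D X True))) ∧
        (¬ CombDMR.IsYesInstance 2 D → construct ⟨n, D⟩ = none)) ∧
    -- the two 2-SAT instances and their candidate distance matrices
    (∀ (n : ℕ) (D : Matrix (Fin n) (Fin n) ℕ), CombDMR.IsDistanceMatrix D →
      (∀ X, CombDMR.Satisfies X (CombDMR.phi₂ D) → ∀ i j,
        (CombDMR.candidate D X False).edist (Sum.inl i) (Sum.inl j) =
          CombDMR.skeletonDist D 2 i j) ∧
      (∀ X, CombDMR.Satisfies X (CombDMR.phi₂' D) → ∀ i j,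
        (CombDMR.candidate D X True).edist (Sum.inl i) (Sum.inl j) =
          CombDMR.skeletonDist D 3 i j) ∧
      ((∃ (V : Type) (_ : Fintype V) (G : SimpleGraph V) (Φ : Fin n → V) (a b : V),
          Fintype.card V = n + 2 ∧ CombDMR.IsRealisation D G Φ ∧
          a ∉ Set.range Φ ∧ b ∉ Set.range Φ ∧ a ≠ b ∧ ¬ G.Adj a b) ↔
        (∃ X, CombDMR.Satisfies X (CombDMR.phi₂ D)) ∧
          ∀ i j, CombDMR.skeletonDist D 2 i j = (D i j : ℕ∞)) ∧
      ((∃ (V : Type) (_ : Fintype V) (G : SimpleGraph V) (Φ : Fin n → V) (a b : V),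
          Fintype.card V = n + 2 ∧ CombDMR.IsRealisation D G Φ ∧
          a ∉ Set.range Φ ∧ b ∉ Set.range Φ ∧ a ≠ b ∧ G.Adj a b) ↔
        (∃ X, CombDMR.Satisfies X (CombDMR.phi₂' D)) ∧
          ∀ i j, CombDMR.skeletonDist D 3 i j = (D i j : ℕ∞))) := by
  refine ⟨?_, fun n D hD => ⟨fun X hX i j => CombDMR.edist_candidate_phi₂ hD hX i j,
    fun X hX i j => CombDMR.edist_candidate_phi₂' hD hX i j, ?_, ?_⟩⟩
  · obtain ⟨A, B, h⟩ := CombDMR.exists_machines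
    refine ⟨_, _, A, B, h, fun n D => ⟨?_, CombDMR.construct_of_isYesInstance,
      CombDMR.construct_of_not_isYesInstance⟩⟩
    rw [CombDMR.isYesInstance_iff, CombDMR.decideYes, Bool.or_eq_true]
  · exact CombDMR.exists_card_eq_iff.trans
      (by simpa [CombDMR.formula] using CombDMR.exists_isRealisation_iff (b := false) hD)
  · exact (CombDMR.exists_card_eq_iff (p := id)).trans
      (by simpa [CombDMR.formula] using CombDMR.exists_isRealisation_iff (b := true) hD)
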